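/- Let $I\subset\mathbb R$ be an open interval, $f:I\to\mathbb R$ smooth and non-vanishing, and let $L^4_1(f,0)=I\times\mathbb E^3$ carry the Lorentzian warped product metric $\tilde g=-dt^2+f(t)^2g_0$, where $g_0$ is the Euclidean metric. Let $\phi:M\to L^4_1(f,0)$ be a space-like surface, that is, a smooth immersion of a smooth $2$-manifold $M$ whose induced metric is positive definite. Decompose $\frac{\partial}{\partial t}=\phi_*T+\eta$ along $\phi$ into its tangential and normal parts. The surface is of class $\mathcal A$ if at every point $p\in M$, for every normal vector $\xi$ at $p$, the shape operator satisfies $A_\xi T=\lambda T$ for some $\lambda\in\mathbb R$ (this is no condition where $T=0$). Consider the following two families of space-like surfaces $\sigma:J\times K\to L^4_1(f,0)$, where $J\subset I$ and $K\subset\mathbb R$ are open intervals. (i) The cylinders $$\sigma(u,v)=(u,x_1(u),x_2(u),v),$$ with $x_1,x_2:J\to\mathbb R$ smooth and $-1+f^2\,(x_1'^2+x_2'^2)>0$ on $J$. (ii) The surfaces $$\sigma(u,v)=\bigl(u,\ \phi_1(v)\alpha(v)+\phi_2(u,v)\alpha'(v)+\phi_3(u,v)n(v)\bigr),$$ where $\alpha:K\to\mathbb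 S^2\subset\mathbb E^3$ is a smooth unit-speed curve, $n$ is a smooth unit vector field along $\alpha$ orthogonal to $\alpha$ and $\alpha'$, $\kappa=g_0(\alpha'',n)$ is its curvature, $$\phi_2(u,v)=\int_{u_0}^uR(\xi)\sin\tau(\xi,v)\,d\xi+\psi_1(v),\qquad \phi_3(u,v)=\int_{u_0}^uR(\xi)\cos\tau(\xi,v)\,d\xi+\psi_2(v)$$ for some $u_0\in J$, and $\phi_1,\psi_1,\psi_2:K\to\mathbb R$, $R:J\to\mathbb R$, $\tau:J\times K\to\mathbb R$ are smooth functions with $$\tau_v=\kappa,\qquad \psi_1'=\kappa\psi_2-\phi_1,\qquad \psi_2'=-\kappa\psi_1,\qquad -1+f^2R^2>0,\qquad \phi_1'-\phi_2>0 .$$ Say that $\phi$ is congruent near $p\in M$ to a surface $\sigma$ of one of these families if there are smooth local coordinates $(u,v)$ of $M$ around $p$, with values in $J\times K$, and a rigid motion $\Phi$ of $\mathbb E^3$ such that $\phi=(\mathrm{id}_I\times\Phi)\circ\sigma$ in these coordinates. Then $M$ is of class $\mathcal A$ if and only if the set of points near which $\phi$ is congruent to a surface of family (i) or (ii) (an open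 subset of $M$) is dense in $\{p\in M: T(p)\neq0\}$, that is, its closure contains every point of $M$ at which $T\neq0$. In particular, if $T$ vanishes nowhere, then $M$ is of class $\mathcal A$ if and only if it is locally congruent to (i) or (ii) on an open dense subset. -/

import Mathlib

open scoped Manifold ContDiff

noncomputable section

namespace RobertsonWalker

/-- The model plane of surfaces. -/
abbrev E2 : Type := EuclideanSpace ℝ (Fin 2)

/-- Euclidean 3-space, the fibre of the space-time. -/
abbrev E3 : Type := EuclideanSpace ℝ (Fin 3)

/-- The vector space `ℝ × E3`; the space-time with base interval `I` is its open subset `I × E3`,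
so its tangent spaces are also `ℝ × E3`. The first component is the `∂/∂t`-component. -/
abbrev Amb : Type := ℝ × E3

/-! ### The ambient space-time: metric and Levi-Civita connection -/

/-- The warped product metric `-dt² + f(t)² g₀` at the point `x`. -/
def metric (f : ℝ → ℝ) (x v w : Amb) : ℝ :=
  -(v.1 * w.1) + f x.1 ^ 2 * inner ℝ v.2 w.2

/-- The comoving observer field `∂/∂t`. -/
def dt : Amb := (1, 0)

/-- The Christoffel symbols of the warped product metric, as a vector-valued bilinear map. -/
def christoffel (f : ℝ → ℝ) (x v w : Amb) : Amb :=
  ((deriv f x.1 / f x.1) * (f x.1 ^ 2 * inner ℝ v.2 w.2),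
    (deriv f x.1 / f x.1) • (v.1 • w.2 + w.1 • v.2))

/-- The covariant derivative of the vector field `Y` in the direction of the vector field `X`. -/
def conn (f : ℝ → ℝ) (X Y : Amb → Amb) (x : Amb) : Amb :=
  fderiv ℝ Y x (X x) + christoffel f x (X x) (Y x)

/-- `conn` has no torsion. -/
theorem conn_torsion_free (f : ℝ → ℝ) (X Y : Amb → Amb) (x : Amb) :
    conn f X Y x - conn f Y X x = VectorField.lieBracket ℝ X Y x := by
  have h : christoffel f x (X x) (Y x) = christoffel f x (Y x) (X x) := by
    unfold christoffel
    rw [real_inner_comm, add_comm]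
  unfold conn
  rw [h, VectorField.lieBracket]
  abel

/-- `conn` is compatible with the metric; so it is the Levi-Civita connection. -/
theorem conn_metric (f : ℝ → ℝ) (X Y Z : Amb → Amb) (x : Amb) (hf : DifferentiableAt ℝ f x.1)
    (hx : f x.1 ≠ 0) (hY : DifferentiableAt ℝ Y x) (hZ : DifferentiableAt ℝ Z x) :
    fderiv ℝ (fun y => metric f y (Y y) (Z y)) x (X x) =
      metric f x (conn f X Y x) (Z x) + metric f x (Y x) (conn f X Z x) := by
  have h1 : HasFDerivAt (fun y : Amb => f y.1)
      ((deriv f x.1) • ContinuousLinearMap.fst ℝ ℝ E3) x :=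
    hf.hasDerivAt.comp_hasFDerivAt x hasFDerivAt_fst
  have hY1 := hY.hasFDerivAt.fst
  have hY2 := hY.hasFDerivAt.snd
  have hZ1 := hZ.hasFDerivAt.fst
  have hZ2 := hZ.hasFDerivAt.snd
  have key := ((hY1.mul hZ1).neg.add ((h1.pow 2).mul (hY2.inner ℝ hZ2))).fderiv
  have e : (fun y => metric f y (Y y) (Z y)) =
      ((-((fun y => (Y y).1) * fun y => (Z y).1)) +
        ((fun y : Amb => f y.1) ^ 2 * fun y => inner ℝ (Y y).2 (Z y).2)) := rfl
  have key2 : fderiv ℝ (fun y => metric f y (Y y) (Z y)) x = _ := key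
  rw [key2]
  simp [metric, conn, christoffel, inner_add_left, inner_add_right, inner_smul_left,
    inner_smul_right, real_inner_comm]
  field_simp
  ring

/-! ### Surfaces in the space-time -/

section Surfaces

variable {M : Type*} [TopologicalSpace M] [ChartedSpace E2 M]

/-- The differential `φ_*` at `p`. -/
def push (φ : M → Amb) (p : M) : TangentSpace (𝓡 2) p →L[ℝ] Amb :=
  mfderiv (𝓡 2) 𝓘(ℝ, Amb) φ p

/-- The induced metric `g` of the surface at `p`. -/
def inducedMetric (f : ℝ → ℝ) (φ : M → Amb) (p : M) (X Y : TangentSpace (𝓡 2) p) : ℝ :=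
  metric f (φ p) (push φ p X) (push φ p Y)

/-- `φ` is a smooth immersion into `I × E3` whose induced metric is positive definite. -/
structure IsSpacelike (I : Set ℝ) (f : ℝ → ℝ) (φ : M → Amb) : Prop where
  smooth : ContMDiff (𝓡 2) 𝓘(ℝ, Amb) ∞ φ
  mem : ∀ p, (φ p).1 ∈ I
  pos : ∀ (p : M) (X : TangentSpace (𝓡 2) p), X ≠ 0 → 0 < inducedMetric f φ p X X

/-- `ξ` is normal to the surface at `p`. -/
def IsNormal (f : ℝ → ℝ) (φ : M → Amb) (p : M) (ξ : Amb) : Prop :=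
  ∀ X : TangentSpace (𝓡 2) p, metric f (φ p) (push φ p X) ξ = 0

/-- The coordinate vectors at `p` of the preferred chart at `p`. -/
def coordVec (p : M) (i : Fin 2) : TangentSpace (𝓡 2) p :=
  (EuclideanSpace.single i (1 : ℝ) : E2)

/-- The matrix `(g_ij)` of the induced metric in the preferred chart at `p`. -/
def gram (f : ℝ → ℝ) (φ : M → Amb) (p : M) : Matrix (Fin 2) (Fin 2) ℝ :=
  Matrix.of fun i j => inducedMetric f φ p (coordVec p i) (coordVec p j)

/-- The tangent vector `V` with `g(V, Y) = l(Y)` for all `Y`, that is `V^i = g^{ij} l_j`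
(see `inducedMetric_raise`). -/
def raise (f : ℝ → ℝ) (φ : M → Amb) (p : M) (l : TangentSpace (𝓡 2) p → ℝ) :
    TangentSpace (𝓡 2) p :=
  ∑ i, ((gram f φ p)⁻¹.mulVec fun j => l (coordVec p j)) i • coordVec p i

/-- The tangential part of the ambient vector `w` at `p`. -/
def tangentPart (f : ℝ → ℝ) (φ : M → Amb) (p : M) (w : Amb) : TangentSpace (𝓡 2) p :=
  raise f φ p fun Y => metric f (φ p) w (push φ p Y)

/-- The normal part of the ambient vector `w` at `p`. -/
def normalPart (f : ℝ → ℝ) (φ : M → Amb) (p : M) (w : Amb) : Amb :=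
  w - push φ p (tangentPart f φ p w)

/-- The covariant derivative in the direction `X` of the field `φ_* Y` along the surface, where `Y`
is extended with constant coefficients in the preferred chart at `p`. -/
def covDeriv (f : ℝ → ℝ) (φ : M → Amb) (p : M) (X Y : TangentSpace (𝓡 2) p) : Amb :=
  fderiv ℝ (fun x : E2 => fderiv ℝ (φ ∘ (extChartAt (𝓡 2) p).symm) x Y) (extChartAt (𝓡 2) p p) X
    + christoffel f (φ p) (push φ p X) (push φ p Y)

/-- The second fundamental form `h(X, Y)`, the normal part of the covariant derivative. -/
def secondFundamentalForm (f : ℝ → ℝ) (φ : M → Amb) (p : M) (X Y : TangentSpace (𝓡 2) p) : Amb :=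
  normalPart f φ p (covDeriv f φ p X Y)

/-- The shape operator `A_ξ`, determined by `g(A_ξ X, Y) = g̃(h(X, Y), ξ)`. -/
def shapeOperator (f : ℝ → ℝ) (φ : M → Amb) (p : M) (ξ : Amb) (X : TangentSpace (𝓡 2) p) :
    TangentSpace (𝓡 2) p :=
  raise f φ p fun Y => metric f (φ p) (secondFundamentalForm f φ p X Y) ξ

/-- The tangential part `T` of the comoving observer field. -/
def comovingTangent (f : ℝ → ℝ) (φ : M → Amb) (p : M) : TangentSpace (𝓡 2) p :=
  tangentPart f φ p dt

/-- Class `𝒜`: at every point, `T` is an eigenvector of all shape operators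
(no condition where `T = 0`). -/
def IsClassA (f : ℝ → ℝ) (φ : M → Amb) : Prop :=
  ∀ (p : M) (ξ : Amb), IsNormal f φ p ξ →
    ∃ c : ℝ, shapeOperator f φ p ξ (comovingTangent f φ p) = c • comovingTangent f φ p

/-- Near `p`, the surface `φ` is congruent to an open part of the surface `σ` with parameter domain
`J × K`: there are local coordinates `(u, v)` of `M` around `p`, with values in `J × K`, and a rigid
motion `Φ` of `E3` such that `φ = (id × Φ) ∘ σ` in these coordinates. -/
def IsCongruentNear (φ : M → Amb) (p : M) (J K : Set ℝ) (σ : ℝ → ℝ → Amb) : Prop :=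
  ∃ e ∈ IsManifold.maximalAtlas (𝓡 2) ∞ M, p ∈ e.source ∧ ∃ Φ : E3 ≃ᵃⁱ[ℝ] E3,
    ∀ x ∈ e.target, x 0 ∈ J ∧ x 1 ∈ K ∧
      φ (e.symm x) = ((σ (x 0) (x 1)).1, Φ (σ (x 0) (x 1)).2)

theorem metric_comm (f : ℝ → ℝ) (x v w : Amb) : metric f x v w = metric f x w v := by
  unfold metric
  rw [real_inner_comm, mul_comm v.1]

theorem inducedMetric_add_smul (f : ℝ → ℝ) (φ : M → Amb) (p : M) (a b : ℝ)
    (X Y Z : TangentSpace (𝓡 2) p) :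
    inducedMetric f φ p (a • X + b • Y) Z =
      a * inducedMetric f φ p X Z + b * inducedMetric f φ p Y Z := by
  simp only [inducedMetric, metric, map_add, map_smul, Prod.fst_add, Prod.snd_add, Prod.smul_fst,
    Prod.smul_snd, inner_add_left, real_inner_smul_left, smul_eq_mul]
  ring

theorem inducedMetric_comm (f : ℝ → ℝ) (φ : M → Amb) (p : M) (X Y : TangentSpace (𝓡 2) p) :
    inducedMetric f φ p X Y = inducedMetric f φ p Y X :=
  metric_comm _ _ _ _

/-- `raise` solves `g(V, Y) = l(Y)`. -/
theorem inducedMetric_raise {I : Set ℝ} {f : ℝ → ℝ} {φ : M → Amb} (h : IsSpacelike I f φ) (p : M)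
    (l : TangentSpace (𝓡 2) p →ₗ[ℝ] ℝ) (Y : TangentSpace (𝓡 2) p) :
    inducedMetric f φ p (raise f φ p l) Y = l Y := by
  obtain ⟨a, b, hY⟩ : ∃ a b : ℝ, Y = a • coordVec p 0 + b • coordVec p 1 := by
    let Z : E2 := Y
    refine ⟨Z 0, Z 1, ?_⟩
    change Z = Z 0 • EuclideanSpace.single (0 : Fin 2) (1 : ℝ)
      + Z 1 • EuclideanSpace.single (1 : Fin 2) (1 : ℝ)
    ext i
    fin_cases i <;> simp
  have hdet : (gram f φ p).det ≠ 0 := by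
    intro h0
    obtain ⟨v, hv, hv0⟩ := Matrix.exists_mulVec_eq_zero_iff.2 h0
    set X : TangentSpace (𝓡 2) p := v 0 • coordVec p 0 + v 1 • coordVec p 1 with hX
    have hX0 : X ≠ 0 := by
      intro hz
      have hz' : (v 0 • EuclideanSpace.single (0 : Fin 2) (1 : ℝ)
        + v 1 • EuclideanSpace.single (1 : Fin 2) (1 : ℝ) : E2) = 0 := hz
      apply hv
      ext i
      have := congrArg (fun w : E2 => w i) hz'
      fin_cases i <;> simpa using this
    have hp := h.pos p X hX0
    have a0 := congrFun hv0 0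
    have a1 := congrFun hv0 1
    simp only [Matrix.mulVec, dotProduct, gram, Matrix.of_apply, Fin.sum_univ_two,
      Pi.zero_apply] at a0 a1
    rw [hX, inducedMetric_add_smul, inducedMetric_comm _ _ _ (coordVec p 0),
      inducedMetric_comm _ _ _ (coordVec p 1), inducedMetric_add_smul,
      inducedMetric_add_smul, inducedMetric_comm _ _ _ (coordVec p 1) (coordVec p 0)] at hp
    rw [inducedMetric_comm _ _ _ (coordVec p 1) (coordVec p 0)] at a1
    refine absurd hp (not_lt.2 (le_of_eq ?_))
    linear_combination v 0 * a0 + v 1 * a1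
  have hm : (gram f φ p).mulVec ((gram f φ p)⁻¹.mulVec fun j => l (coordVec p j)) =
      fun j => l (coordVec p j) := by
    rw [Matrix.mulVec_mulVec, Matrix.mul_nonsing_inv _ (isUnit_iff_ne_zero.2 hdet),
      Matrix.one_mulVec]
  have key : ∀ j, inducedMetric f φ p (raise f φ p l) (coordVec p j) = l (coordVec p j) := by
    intro j
    have := congrFun hm j
    rw [← this]
    simp only [raise, Fin.sum_univ_two, inducedMetric_add_smul]
    simp only [Matrix.mulVec, dotProduct, Fin.sum_univ_two, gram, Matrix.of_apply]
    rw [inducedMetric_comm f φ p (coordVec p j) (coordVec p 0),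
      inducedMetric_comm f φ p (coordVec p j) (coordVec p 1)]
    ring
  rw [hY, inducedMetric_comm, inducedMetric_add_smul, inducedMetric_comm, key,
    inducedMetric_comm, key, map_add, map_smul, map_smul, smul_eq_mul, smul_eq_mul]

end Surfaces

/-! ### The two families -/

/-- The cylinder `(u, v) ↦ (u, x₁(u), x₂(u), v)` over `J × K`, space-like. -/
def IsCylinder (I : Set ℝ) (f : ℝ → ℝ) (J K : Set ℝ) (σ : ℝ → ℝ → Amb) : Prop :=
  IsOpen J ∧ J.OrdConnected ∧ J ⊆ I ∧ IsOpen K ∧ K.OrdConnected ∧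
  ∃ x₁ x₂ : ℝ → ℝ, ContDiffOn ℝ ∞ x₁ J ∧ ContDiffOn ℝ ∞ x₂ J ∧
    (∀ u ∈ J, 0 < -1 + f u ^ 2 * (deriv x₁ u ^ 2 + deriv x₂ u ^ 2)) ∧
    ∀ u ∈ J, ∀ v ∈ K, σ u v = (u, !₂[x₁ u, x₂ u, v])

/-- `α` is a smooth curve `K → S²` parametrized by arc length, with smooth unit normal `n` in `S²`
and (geodesic) curvature `κ`. -/
structure IsSphericalFrame (K : Set ℝ) (α n : ℝ → E3) (κ : ℝ → ℝ) : Prop where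
  smooth : ContDiffOn ℝ ∞ α K
  smooth_normal : ContDiffOn ℝ ∞ n K
  sphere : ∀ v ∈ K, ‖α v‖ = 1
  unit_speed : ∀ v ∈ K, ‖deriv α v‖ = 1
  unit_normal : ∀ v ∈ K, ‖n v‖ = 1
  normal_pos : ∀ v ∈ K, inner ℝ (α v) (n v) = 0
  normal_tangent : ∀ v ∈ K, inner ℝ (deriv α v) (n v) = 0
  curvature : ∀ v ∈ K, κ v = inner ℝ (deriv (deriv α) v) (n v)

/-- The surface `(u, v) ↦ (u, φ₁(v) α(v) + φ₂(u, v) α'(v) + φ₃(u, v) n(v))` over `J × K`,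
space-like, with `φ₂`, `φ₃` built from `R`, `τ`, `ψ₁`, `ψ₂`. -/
def IsFrameSurface (I : Set ℝ) (f : ℝ → ℝ) (J K : Set ℝ) (σ : ℝ → ℝ → Amb) : Prop :=
  IsOpen J ∧ J.OrdConnected ∧ J ⊆ I ∧ IsOpen K ∧ K.OrdConnected ∧
  ∃ (α n : ℝ → E3) (κ : ℝ → ℝ) (φ₁ ψ₁ ψ₂ R : ℝ → ℝ) (τ φ₂ φ₃ : ℝ → ℝ → ℝ) (u₀ : ℝ),
    IsSphericalFrame K α n κ ∧ u₀ ∈ J ∧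
    ContDiffOn ℝ ∞ φ₁ K ∧ ContDiffOn ℝ ∞ ψ₁ K ∧ ContDiffOn ℝ ∞ ψ₂ K ∧ ContDiffOn ℝ ∞ R J ∧
    ContDiffOn ℝ ∞ (Function.uncurry τ) (J ×ˢ K) ∧
    (∀ u ∈ J, ∀ v ∈ K, deriv (fun w => τ u w) v = κ v) ∧
    (∀ v ∈ K, deriv ψ₁ v = κ v * ψ₂ v - φ₁ v) ∧
    (∀ v ∈ K, deriv ψ₂ v = -(κ v * ψ₁ v)) ∧
    (∀ u ∈ J, ∀ v ∈ K, φ₂ u v = (∫ ξ in u₀..u, R ξ * Real.sin (τ ξ v)) + ψ₁ v) ∧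
    (∀ u ∈ J, ∀ v ∈ K, φ₃ u v = (∫ ξ in u₀..u, R ξ * Real.cos (τ ξ v)) + ψ₂ v) ∧
    (∀ u ∈ J, 0 < -1 + f u ^ 2 * R u ^ 2) ∧
    (∀ u ∈ J, ∀ v ∈ K, 0 < deriv φ₁ v - φ₂ u v) ∧
    ∀ u ∈ J, ∀ v ∈ K, σ u v = (u, φ₁ v • α v + φ₂ u v • deriv α v + φ₃ u v • n v)

end RobertsonWalker

end

/-!
Write the surface locally as `(t, r)` with values in `ℝ × E3`. The field `T` is minus the gradient
of `t`, so it vanishes exactly where `dt = 0`. Where `T ≠ 0`, the normal bundle being nondegenerate,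
the class `𝒜` condition says `h(T, Y) = 0` for the vectors `Y` tangent to the level curves of `t`.
The Christoffel terms of `(T, Y)` are tangent to the surface, so the condition only involves the
second derivative of `(t, r)`: it is `IsPrincipalAt`, which is independent of the coordinates.
It says that the unit direction `w` in `E3` of the level curves of `t` (`levelDir`) is constant
along the curves orthogonal to them (`isPrincipalAt_iff_fderiv_levelDir`).

This equation supplies orthogonal coordinates without integrating a vector field. Any function `s`
that is constant along the orthogonal curves and regular along the level curves is, together with
`t`, a coordinate system with orthogonal coordinate curves (`exists_adapted_coordinates`).

* Where `w` is locally constant, `s = ⟪w, r⟫` has this property, and the surface is a cylinder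
  (`exists_isCylinder`).
* Where `w` is not stationary, a component of `w` has this property. So `w` traces a spherical
  curve, and the arc length of that curve, as a function on the surface, is the second coordinate
  `v`. Then `r_v` is a positive multiple of `α(v) = w`, and expanding `r` in the frame `α, α', n` gives
  a frame surface (`isFrameSurface_of_direction`).

The points of one of these two kinds are dense where `T ≠ 0`. Conversely the surfaces of both
families satisfy the condition (`isPrincipalAt_of_hasRuledLevels`), and at the points with `T ≠ 0`
the condition is closed.
-/

noncomputable section

namespace RobertsonWalker

/-! ### Linear algebra in the model plane -/

/-- The vector spanning the kernel of a nonzero linear form on the plane: the rotation by a right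
angle of its coefficient vector. -/
def kerVec (l : E2 →L[ℝ] ℝ) : E2 :=
  !₂[-l (EuclideanSpace.single 1 1), l (EuclideanSpace.single 0 1)]

theorem eq_smul_single_add (Y : E2) :
    Y = Y 0 • EuclideanSpace.single (0 : Fin 2) (1 : ℝ) +
      Y 1 • EuclideanSpace.single (1 : Fin 2) (1 : ℝ) := by
  ext i
  fin_cases i <;> simp

theorem apply_eq_coords (l : E2 →L[ℝ] ℝ) (Y : E2) :
    l Y = Y 0 * l (EuclideanSpace.single 0 1) + Y 1 * l (EuclideanSpace.single 1 1) := by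
  conv_lhs => rw [eq_smul_single_add Y]
  simp

theorem apply_kerVec (l : E2 →L[ℝ] ℝ) : l (kerVec l) = 0 := by
  rw [apply_eq_coords]
  simp [kerVec]
  ring

theorem eq_zero_of_kerVec_eq_zero {l : E2 →L[ℝ] ℝ} (h : kerVec l = 0) : l = 0 := by
  have h0 := congrArg (fun w : E2 => w 0) h
  have h1 := congrArg (fun w : E2 => w 1) h
  simp [kerVec] at h0 h1
  ext Y
  rw [apply_eq_coords, h0, h1]
  simp

theorem exists_eq_smul_kerVec {l : E2 →L[ℝ] ℝ} (hl : l ≠ 0) {Y : E2} (hY : l Y = 0) :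
    ∃ c : ℝ, Y = c • kerVec l := by
  rw [apply_eq_coords] at hY
  by_cases h0 : l (EuclideanSpace.single 0 1) = 0
  · have h1 : l (EuclideanSpace.single 1 1) ≠ 0 := by
      intro h1
      apply hl
      ext Z
      rw [apply_eq_coords, h0, h1]
      simp
    rw [h0] at hY
    have hY1 : Y 1 = 0 := by simpa [h1] using hY
    refine ⟨-Y 0 / l (EuclideanSpace.single 1 1), ?_⟩
    ext i
    fin_cases i
    · simp [kerVec]
      field_simp
    · simp [kerVec, h0, hY1]
  · refine ⟨Y 1 / l (EuclideanSpace.single 0 1), ?_⟩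
    ext i
    fin_cases i
    · simp [kerVec]
      field_simp
      linarith
    · simp [kerVec]
      field_simp

/-- Two vectors of the plane on which a pair of linear forms is diagonal and invertible span it. -/
theorem exists_eq_smul_add_smul {l m : E2 →L[ℝ] ℝ} {X Y : E2} (hX : l X ≠ 0) (hY : l Y = 0)
    (hY' : m Y ≠ 0) (Z : E2) : ∃ a b : ℝ, Z = a • X + b • Y := by
  have hl : l ≠ 0 := fun h => hX (by simp [h])
  obtain ⟨c, hc⟩ := exists_eq_smul_kerVec hl hY
  have hc0 : c ≠ 0 := by
    rintro rfl
    apply hY'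
    simp [hc]
  obtain ⟨d, hd⟩ := exists_eq_smul_kerVec hl (Y := Z - (l Z / l X) • X)
    (by simp; field_simp; ring)
  refine ⟨l Z / l X, d / c, ?_⟩
  rw [hc, smul_smul, div_mul_cancel₀ _ hc0, ← hd]
  abel

theorem contDiffAt_kerVec {E : Type*} [NormedAddCommGroup E] [NormedSpace ℝ E]
    {l : E → E2 →L[ℝ] ℝ} {x : E} (hl : ContDiffAt ℝ ∞ l x) :
    ContDiffAt ℝ ∞ (fun y => kerVec (l y)) x := by
  rw [contDiffAt_euclidean]
  intro i
  fin_cases i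
  · simp [kerVec]
    exact (hl.clm_apply contDiffAt_const).neg
  · simp [kerVec]
    exact hl.clm_apply contDiffAt_const

/-! ### Spacelike maps of the plane and the principal direction condition -/

/-- The metric induced at `x` by the map `F` from the plane is positive definite. -/
def IsSpacelikeAt (f : ℝ → ℝ) (F : E2 → Amb) (x : E2) : Prop :=
  ∀ X : E2, X ≠ 0 → 0 < metric f (F x) (fderiv ℝ F x X) (fderiv ℝ F x X)

/-- The second derivative of `F` at `x` in the direction of a vector `Y` tangent to the level set of
the time component and a vector `X` orthogonal to `Y` is tangent to `F`. Where the time component is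
regular and `Y ≠ 0`, `X` is proportional to the tangential part of `∂/∂t`, and the Christoffel terms
of `(X, Y)` are tangent to `F`: this is the equation `h(T, Y) = 0`. -/
def IsPrincipalAt (F : E2 → Amb) (x : E2) : Prop :=
  ∀ X Y : E2, (fderiv ℝ F x Y).1 = 0 → inner ℝ (fderiv ℝ F x X).2 (fderiv ℝ F x Y).2 = 0 →
    ∃ Z : E2, fderiv ℝ (fun y => fderiv ℝ F y Y) x X = fderiv ℝ F x Z

theorem IsPrincipalAt.congr {F G : E2 → Amb} {x : E2} (h : IsPrincipalAt F x)
    (hFG : F =ᶠ[nhds x] G) : IsPrincipalAt G x := by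
  have h1 := hFG.fderiv (𝕜 := ℝ)
  intro X Y hY hXY
  rw [← h1.eq_of_nhds] at hY hXY ⊢
  have h2 : (fun y => fderiv ℝ F y Y) =ᶠ[nhds x] fun y => fderiv ℝ G y Y := by
    filter_upwards [h1] with y hy
    rw [hy]
  rw [← h2.fderiv_eq]
  exact h X Y hY hXY

theorem contDiffAt_fderiv {E G : Type*} [NormedAddCommGroup E] [NormedSpace ℝ E]
    [NormedAddCommGroup G] [NormedSpace ℝ G] {F : E → G} {x : E}
    (hF : ContDiffAt ℝ ∞ F x) : ContDiffAt ℝ ∞ (fderiv ℝ F) x :=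
  hF.fderiv_right (m := ∞) (by simp)

theorem eventually_differentiableAt {E G : Type*} [NormedAddCommGroup E] [NormedSpace ℝ E]
    [NormedAddCommGroup G] [NormedSpace ℝ G] {F : E → G} {x : E}
    (hF : ContDiffAt ℝ ∞ F x) : ∀ᶠ y in nhds x, DifferentiableAt ℝ F y := by
  have h1 : ContDiffAt ℝ 1 F x := hF.of_le (by norm_cast)
  filter_upwards [h1.eventually (by simp)] with y hy
  exact hy.differentiableAt (by simp)

theorem fderiv_fderiv_apply {E G : Type*} [NormedAddCommGroup E] [NormedSpace ℝ E]
    [NormedAddCommGroup G] [NormedSpace ℝ G] {F : E → G} {x : E}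
    (hF : ContDiffAt ℝ ∞ F x) (X Y : E) :
    fderiv ℝ (fun y => fderiv ℝ F y Y) x X = fderiv ℝ (fderiv ℝ F) x X Y := by
  have hd : DifferentiableAt ℝ (fderiv ℝ F) x := (contDiffAt_fderiv hF).differentiableAt (by simp)
  rw [(hd.hasFDerivAt.clm_apply (hasFDerivAt_const Y x)).fderiv]
  simp

/-- The condition does not depend on the coordinates: the second derivatives of the coordinate
change contribute vectors tangent to `F`. -/
theorem IsPrincipalAt.comp {F : E2 → Amb} {ψ : E2 → E2} {x : E2} (hF : ContDiffAt ℝ ∞ F (ψ x))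
    (hψ : ContDiffAt ℝ ∞ ψ x) (hs : Function.Surjective (fderiv ℝ ψ x))
    (h : IsPrincipalAt F (ψ x)) : IsPrincipalAt (F ∘ ψ) x := by
  have hF1 : DifferentiableAt ℝ F (ψ x) := hF.differentiableAt (by simp)
  have hψ1 : DifferentiableAt ℝ ψ x := hψ.differentiableAt (by simp)
  have e0 : fderiv ℝ (F ∘ ψ) x = (fderiv ℝ F (ψ x)).comp (fderiv ℝ ψ x) := fderiv_comp x hF1 hψ1
  intro X Y hY hXY
  rw [e0] at hY hXY ⊢
  obtain ⟨Z, hZ⟩ := h (fderiv ℝ ψ x X) (fderiv ℝ ψ x Y) hY hXY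
  have hev : (fun y => fderiv ℝ (F ∘ ψ) y Y) =ᶠ[nhds x]
      fun y => fderiv ℝ F (ψ y) (fderiv ℝ ψ y Y) := by
    filter_upwards [hψ.continuousAt.eventually (eventually_differentiableAt hF),
      eventually_differentiableAt hψ] with y hy1 hy2
    rw [fderiv_comp y hy1 hy2]
    rfl
  have hdF : DifferentiableAt ℝ (fderiv ℝ F) (ψ x) :=
    (contDiffAt_fderiv hF).differentiableAt (by simp)
  have hdψ : DifferentiableAt ℝ (fderiv ℝ ψ) x :=
    (contDiffAt_fderiv hψ).differentiableAt (by simp)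
  have h1 : HasFDerivAt (fun y => fderiv ℝ F (ψ y)) ((fderiv ℝ (fderiv ℝ F) (ψ x)).comp
      (fderiv ℝ ψ x)) x := hdF.hasFDerivAt.comp x hψ1.hasFDerivAt
  have h2 : HasFDerivAt (fun y => fderiv ℝ ψ y Y)
      ((fderiv ℝ (fderiv ℝ ψ) x).flip Y) x := by
    have := hdψ.hasFDerivAt.clm_apply (hasFDerivAt_const Y x)
    simpa using this
  have h3 := (h1.clm_apply h2).fderiv
  rw [fderiv_fderiv_apply hF] at hZ
  obtain ⟨V, hV⟩ := hs (Z + fderiv ℝ (fderiv ℝ ψ) x X Y)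
  refine ⟨V, ?_⟩
  rw [hev.fderiv_eq, h3]
  simp only [add_apply, ContinuousLinearMap.comp_apply,
    ContinuousLinearMap.flip_apply, hV, map_add, hZ]
  abel

theorem IsSpacelikeAt.comp {f : ℝ → ℝ} {F : E2 → Amb} {ψ : E2 → E2} {x : E2}
    (hF : DifferentiableAt ℝ F (ψ x)) (hψ : DifferentiableAt ℝ ψ x)
    (hi : Function.Injective (fderiv ℝ ψ x)) (h : IsSpacelikeAt f F (ψ x)) :
    IsSpacelikeAt f (F ∘ ψ) x := by
  intro X hX
  rw [fderiv_comp x hF hψ]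
  exact h _ fun h0 => hX (hi (h0.trans (map_zero _).symm))

/-! ### The direction field of the level curves -/

/-- The time component of the differential of `F`. -/
def timeForm (F : E2 → Amb) (x : E2) : E2 →L[ℝ] ℝ :=
  (ContinuousLinearMap.fst ℝ ℝ E3).comp (fderiv ℝ F x)

/-- A vector field tangent to the level curves of the time component of `F`. -/
def levelVec (F : E2 → Amb) (x : E2) : E2 := kerVec (timeForm F x)

/-- The velocity in `E3` of the level curves of the time component of `F`. -/
def levelVel (F : E2 → Amb) (x : E2) : E3 := (fderiv ℝ F x (levelVec F x)).2

/-- The product of the space component of the differential of `F` with the velocity of the level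
curves. -/
def levelForm (F : E2 → Amb) (x : E2) : E2 →L[ℝ] ℝ :=
  (innerSL ℝ (levelVel F x)).comp ((ContinuousLinearMap.snd ℝ ℝ E3).comp (fderiv ℝ F x))

/-- A vector field orthogonal to the level curves of the time component of `F`. -/
def orthVec (F : E2 → Amb) (x : E2) : E2 := kerVec (levelForm F x)

/-- The unit direction in `E3` of the level curves of the time component of `F`. -/
def levelDir (F : E2 → Amb) (x : E2) : E3 := ‖levelVel F x‖⁻¹ • levelVel F x

theorem fst_levelVec (F : E2 → Amb) (x : E2) : (fderiv ℝ F x (levelVec F x)).1 = 0 :=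
  apply_kerVec (timeForm F x)

theorem inner_levelVel_orthVec (F : E2 → Amb) (x : E2) :
    inner ℝ (levelVel F x) (fderiv ℝ F x (orthVec F x)).2 = 0 :=
  apply_kerVec (levelForm F x)

section LevelCurves

variable {f : ℝ → ℝ} {F : E2 → Amb} {x : E2}

theorem levelVel_ne_zero (hs : IsSpacelikeAt f F x) (ht : timeForm F x ≠ 0) :
    levelVel F x ≠ 0 := by
  intro h0
  have h1 : levelVec F x ≠ 0 := fun h => ht (eq_zero_of_kerVec_eq_zero h)
  have h2 := hs _ h1
  have h3 : (fderiv ℝ F x (levelVec F x)).2 = 0 := h0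
  simp [metric, fst_levelVec, h3] at h2

theorem levelForm_levelVec (F : E2 → Amb) (x : E2) :
    levelForm F x (levelVec F x) = ‖levelVel F x‖ ^ 2 :=
  real_inner_self_eq_norm_sq (levelVel F x)

theorem levelForm_ne_zero (h : levelVel F x ≠ 0) : levelForm F x ≠ 0 := by
  intro h0
  have := levelForm_levelVec F x
  rw [h0] at this
  exact h (norm_eq_zero.1 (pow_eq_zero_iff two_ne_zero |>.1 this.symm))

theorem timeForm_orthVec_ne_zero (h : levelVel F x ≠ 0) (ht : timeForm F x ≠ 0) :
    timeForm F x (orthVec F x) ≠ 0 := by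
  intro h0
  obtain ⟨c, hc⟩ := exists_eq_smul_kerVec ht h0
  have h1 : levelForm F x (orthVec F x) = 0 := apply_kerVec _
  have h2 : levelForm F x (orthVec F x) = c * ‖levelVel F x‖ ^ 2 := by
    rw [hc, map_smul, smul_eq_mul]
    congr 1
    exact levelForm_levelVec F x
  have hc0 : c = 0 := by
    rw [h1] at h2
    simpa [h] using h2.symm
  rw [hc0, zero_smul] at hc
  exact levelForm_ne_zero h (eq_zero_of_kerVec_eq_zero hc)

theorem levelVel_eq_smul_levelDir (F : E2 → Amb) (x : E2) :
    levelVel F x = ‖levelVel F x‖ • levelDir F x := by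
  by_cases h : levelVel F x = 0
  · simp [levelDir, h]
  · rw [levelDir, smul_smul, mul_inv_cancel₀ (norm_ne_zero_iff.2 h), one_smul]

theorem norm_levelDir (h : levelVel F x ≠ 0) : ‖levelDir F x‖ = 1 := by
  rw [levelDir, norm_smul, norm_inv, norm_norm, inv_mul_cancel₀ (norm_ne_zero_iff.2 h)]

theorem contDiffAt_timeForm (hF : ContDiffAt ℝ ∞ F x) : ContDiffAt ℝ ∞ (timeForm F) x :=
  contDiffAt_const.clm_comp (contDiffAt_fderiv hF)

theorem contDiffAt_levelVec (hF : ContDiffAt ℝ ∞ F x) : ContDiffAt ℝ ∞ (levelVec F) x :=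
  contDiffAt_kerVec (contDiffAt_timeForm hF)

theorem contDiffAt_levelVel (hF : ContDiffAt ℝ ∞ F x) : ContDiffAt ℝ ∞ (levelVel F) x :=
  ((contDiffAt_fderiv hF).clm_apply (contDiffAt_levelVec hF)).snd

theorem contDiffAt_orthVec (hF : ContDiffAt ℝ ∞ F x) : ContDiffAt ℝ ∞ (orthVec F) x := by
  refine contDiffAt_kerVec ?_
  exact ((innerSL ℝ (E := E3)).contDiff.contDiffAt.comp x (contDiffAt_levelVel hF)).clm_comp
    (contDiffAt_const.clm_comp (contDiffAt_fderiv hF))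

theorem contDiffAt_levelDir (hF : ContDiffAt ℝ ∞ F x) (h : levelVel F x ≠ 0) :
    ContDiffAt ℝ ∞ (levelDir F) x :=
  (((contDiffAt_levelVel hF).norm ℝ h).inv (norm_ne_zero_iff.2 h)).smul (contDiffAt_levelVel hF)

/-- The direction of a nonvanishing field is stationary exactly if its derivative is proportional to
the field. -/
theorem fderiv_levelDir_eq_zero_iff (hF : ContDiffAt ℝ ∞ F x) (h : levelVel F x ≠ 0) (X : E2) :
    fderiv ℝ (levelDir F) x X = 0 ↔ ∃ c : ℝ, fderiv ℝ (levelVel F) x X = c • levelVel F x := by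
  have hV := (contDiffAt_levelVel hF).differentiableAt (by simp)
  have hD := (contDiffAt_levelDir hF h).differentiableAt (by simp)
  have hN : DifferentiableAt ℝ (fun y => ‖levelVel F y‖) x :=
    ((contDiffAt_levelVel hF).norm ℝ h).differentiableAt (by simp)
  have hn : ‖levelVel F x‖ ≠ 0 := norm_ne_zero_iff.2 h
  have e1 : fderiv ℝ (levelVel F) x X = ‖levelVel F x‖ • fderiv ℝ (levelDir F) x X +
      fderiv ℝ (fun y => ‖levelVel F y‖) x X • levelDir F x := by
    have e : levelVel F = (fun y => ‖levelVel F y‖) • levelDir F :=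
      funext (levelVel_eq_smul_levelDir F)
    have h3 := (hN.hasFDerivAt.smul hD.hasFDerivAt).fderiv
    rw [← e] at h3
    rw [h3]
    simp
  constructor
  · intro h0
    refine ⟨fderiv ℝ (fun y => ‖levelVel F y‖) x X * ‖levelVel F x‖⁻¹, ?_⟩
    rw [e1, h0, smul_zero, zero_add, levelDir, smul_smul]
  · rintro ⟨c, hc⟩
    -- the direction has constant norm, so its derivative is orthogonal to it
    have ho : inner ℝ (levelDir F x) (fderiv ℝ (levelDir F) x X) = 0 := by
      have hev : (fun y => inner ℝ (levelDir F y) (levelDir F y)) =ᶠ[nhds x]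
          fun _ => (1 : ℝ) := by
        filter_upwards [(contDiffAt_levelVel hF).continuousAt.eventually_ne h] with y hy
        rw [real_inner_self_eq_norm_sq, norm_levelDir hy, one_pow]
      have h4 := (hD.hasFDerivAt.inner ℝ hD.hasFDerivAt).fderiv
      rw [hev.fderiv_eq] at h4
      have h5 := congrArg (fun l : E2 →L[ℝ] ℝ => l X) h4
      simp [real_inner_comm] at h5
      linarith
    have h6 : ‖levelVel F x‖ • fderiv ℝ (levelDir F) x X =
        (c * ‖levelVel F x‖ - fderiv ℝ (fun y => ‖levelVel F y‖) x X) • levelDir F x := by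
      have e2 : c • levelVel F x = (c * ‖levelVel F x‖) • levelDir F x := by
        rw [mul_smul, ← levelVel_eq_smul_levelDir]
      rw [sub_smul, ← e2, ← hc, e1]
      abel
    have h7 := congrArg (fun v => inner ℝ v (fderiv ℝ (levelDir F) x X)) h6
    simp only [inner_smul_left, ho, mul_zero, real_inner_self_eq_norm_sq] at h7
    simpa [hn] using h7

/-- Where the time component is regular, the principal direction condition says that the direction
of the level curves is constant along their orthogonal trajectories. -/
theorem isPrincipalAt_iff_fderiv_levelDir (hF : ContDiffAt ℝ ∞ F x) (ht : timeForm F x ≠ 0)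
    (h : levelVel F x ≠ 0) :
    IsPrincipalAt F x ↔ fderiv ℝ (levelDir F) x (orthVec F x) = 0 := by
  rw [fderiv_levelDir_eq_zero_iff hF h]
  have hdF : DifferentiableAt ℝ (fderiv ℝ F) x :=
    (contDiffAt_fderiv hF).differentiableAt (by simp)
  have hY : DifferentiableAt ℝ (levelVec F) x :=
    (contDiffAt_levelVec hF).differentiableAt (by simp)
  set Y₀ := levelVec F x with hY₀
  set X₀ := orthVec F x with hX₀
  set V := fderiv ℝ (levelVec F) x X₀ with hV
  have hc := fderiv_fderiv_apply hF
  have hYY := hdF.hasFDerivAt.clm_apply hY.hasFDerivAt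
  have h1 : (fderiv ℝ (fderiv ℝ F) x X₀ Y₀).1 + (fderiv ℝ F x V).1 = 0 := by
    have e := hYY.fst.fderiv
    have e' : (fun y => (fderiv ℝ F y (levelVec F y)).1) = fun _ => 0 :=
      funext (fst_levelVec F)
    rw [e'] at e
    have := congrArg (fun l : E2 →L[ℝ] ℝ => l X₀) e
    simp at this
    linarith
  have h2 : fderiv ℝ (levelVel F) x X₀ =
      (fderiv ℝ (fderiv ℝ F) x X₀ Y₀).2 + (fderiv ℝ F x V).2 := by
    have e := hYY.snd.fderiv
    have e' : fderiv ℝ (levelVel F) x = _ := e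
    rw [e']
    simp [hV, hY₀, add_comm]
  constructor
  · intro hp
    obtain ⟨Z, hZ⟩ := hp X₀ Y₀ (fst_levelVec F x)
      (by rw [real_inner_comm]; exact inner_levelVel_orthVec F x)
    rw [hc] at hZ
    have h3 : timeForm F x (Z + V) = 0 := by
      rw [map_add]
      rw [hZ] at h1
      exact h1
    obtain ⟨c, hcZ⟩ := exists_eq_smul_kerVec ht h3
    refine ⟨c, ?_⟩
    rw [h2, hZ, ← Prod.snd_add, ← map_add, hcZ, map_smul]
    rfl
  · rintro ⟨c, hcV⟩ X Y hY hXY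
    rw [hc]
    obtain ⟨b, hb⟩ := exists_eq_smul_kerVec ht hY
    by_cases hb0 : b = 0
    · refine ⟨0, ?_⟩
      simp [hb, hb0]
    · have hX : levelForm F x X = 0 := by
        rw [hb, map_smul, Prod.smul_snd, inner_smul_right] at hXY
        have := (mul_eq_zero.1 hXY).resolve_left hb0
        rw [real_inner_comm] at this
        exact this
      obtain ⟨a, ha⟩ := exists_eq_smul_kerVec (levelForm_ne_zero h) hX
      refine ⟨(a * b) • (c • Y₀ - V), ?_⟩
      have e : fderiv ℝ (fderiv ℝ F) x X₀ Y₀ = fderiv ℝ F x (c • Y₀ - V) := by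
        rw [map_sub, map_smul]
        refine Prod.ext ?_ ?_
        · have := fst_levelVec F x
          simp only [Prod.fst_sub, Prod.smul_fst, hY₀, this, smul_zero]
          linarith
        · rw [h2] at hcV
          simp only [Prod.snd_sub, Prod.smul_snd]
          rw [eq_sub_iff_add_eq]
          exact hcV
      rw [map_smul, ← e, ha, hb]
      change fderiv ℝ (fderiv ℝ F) x (a • X₀) (b • Y₀) = _
      simp [smul_smul, mul_comm]

end LevelCurves

/-! ### Antiderivatives and polar form on an open interval -/

theorem hasDerivAt_intervalIntegral {E : Type*} [NormedAddCommGroup E] [NormedSpace ℝ E]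
    [CompleteSpace E] {K : Set ℝ} (hK : IsOpen K) (hK' : K.OrdConnected) {g : ℝ → E}
    (hg : ContinuousOn g K) {a v : ℝ} (ha : a ∈ K) (hv : v ∈ K) :
    HasDerivAt (fun w => ∫ x in a..w, g x) (g v) v := by
  refine intervalIntegral.integral_hasDerivAt_right ?_ ?_ (hg.continuousAt (hK.mem_nhds hv))
  · exact (hg.mono (hK'.uIcc_subset ha hv)).intervalIntegrable
  · exact hg.stronglyMeasurableAtFilter hK v hv

theorem exists_contDiffOn_antiderivative {E : Type*} [NormedAddCommGroup E] [NormedSpace ℝ E]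
    [CompleteSpace E] {K : Set ℝ} (hK : IsOpen K) (hK' : K.OrdConnected) {g : ℝ → E}
    (hg : ContDiffOn ℝ ∞ g K) (a : ℝ) (ha : a ∈ K) :
    ∃ G : ℝ → E, G a = 0 ∧ ContDiffOn ℝ ∞ G K ∧ ∀ v ∈ K, HasDerivAt G (g v) v := by
  have hd : ∀ v ∈ K, HasDerivAt (fun w => ∫ x in a..w, g x) (g v) v := fun v hv =>
    hasDerivAt_intervalIntegral hK hK' hg.continuousOn ha hv
  refine ⟨fun w => ∫ x in a..w, g x, intervalIntegral.integral_same, ?_, hd⟩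
  rw [contDiffOn_infty_iff_deriv_of_isOpen hK]
  exact ⟨fun v hv => (hd v hv).differentiableAt.differentiableWithinAt,
    hg.congr fun v hv => (hd v hv).deriv⟩

theorem eq_of_hasDerivAt_eq_zero {E : Type*} [NormedAddCommGroup E] [NormedSpace ℝ E]
    {K : Set ℝ} (hK : IsOpen K) (hK' : K.OrdConnected) {g : ℝ → E}
    (hg : ∀ v ∈ K, HasDerivAt g 0 v) {v w : ℝ} (hv : v ∈ K) (hw : w ∈ K) : g v = g w :=
  hK.is_const_of_deriv_eq_zero hK'.isPreconnected
    (fun x hx => (hg x hx).differentiableAt.differentiableWithinAt)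
    (fun x hx => (hg x hx).deriv) hv hw

/-- A solution of `z' = g z` on an open interval is a multiple of the exponential of an
antiderivative of `g`. -/
theorem eq_mul_exp_of_hasDerivAt {K : Set ℝ} (hK : IsOpen K) (hK' : K.OrdConnected)
    {z g G : ℝ → ℂ} (hz : ∀ v ∈ K, HasDerivAt z (g v * z v) v)
    (hG : ∀ v ∈ K, HasDerivAt G (g v) v) {a v : ℝ} (ha : a ∈ K) (hG0 : G a = 0) (hv : v ∈ K) :
    z v = z a * Complex.exp (G v) := by
  have h : ∀ v ∈ K, HasDerivAt (fun v => z v * Complex.exp (-G v)) 0 v := by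
    intro v hv
    have := (hz v hv).mul (hG v hv).neg.cexp
    refine this.congr_deriv ?_
    ring
  have h2 := eq_of_hasDerivAt_eq_zero hK hK' h hv ha
  simp only [hG0, neg_zero, Complex.exp_zero, mul_one] at h2
  rw [← h2, mul_assoc, ← Complex.exp_add]
  simp

/-- A smooth nonvanishing complex function on an open interval has smooth polar coordinates. -/
theorem exists_polar {K : Set ℝ} (hK : IsOpen K) (hK' : K.OrdConnected) {z : ℝ → ℂ}
    (hz : ContDiffOn ℝ ∞ z K) (hz0 : ∀ v ∈ K, z v ≠ 0) :
    ∃ R θ : ℝ → ℝ, ContDiffOn ℝ ∞ R K ∧ ContDiffOn ℝ ∞ θ K ∧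
      ∀ v ∈ K, z v = R v * Complex.exp (θ v * Complex.I) := by
  rcases K.eq_empty_or_nonempty with rfl | ⟨a, ha⟩
  · exact ⟨0, 0, by simp⟩
  obtain ⟨G, hG0, hGs, hG⟩ := exists_contDiffOn_antiderivative hK hK'
    (((contDiffOn_infty_iff_deriv_of_isOpen hK).1 hz).2.mul (hz.inv hz0)) a ha
  have hd : ∀ v ∈ K, HasDerivAt z (deriv z v * (z v)⁻¹ * z v) v := by
    intro v hv
    rw [inv_mul_cancel_right₀ (hz0 v hv)]
    exact ((hz.differentiableOn (by simp)).differentiableAt (hK.mem_nhds hv)).hasDerivAt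
  have hre : ContDiffOn ℝ ∞ (fun v => (G v).re) K := Complex.reCLM.contDiff.comp_contDiffOn hGs
  have him : ContDiffOn ℝ ∞ (fun v => (G v).im) K := Complex.imCLM.contDiff.comp_contDiffOn hGs
  refine ⟨fun v => ‖z a‖ * Real.exp (G v).re, fun v => Complex.arg (z a) + (G v).im,
    contDiffOn_const.mul hre.exp, contDiffOn_const.add him, fun v hv => ?_⟩
  rw [eq_mul_exp_of_hasDerivAt hK hK' hd hG ha hG0 hv]
  conv_lhs => rw [← Complex.norm_mul_exp_arg_mul_I (z a), ← Complex.re_add_im (G v)]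
  push_cast
  rw [add_mul, Complex.exp_add, Complex.exp_add]
  ring

/-! ### Adapted coordinates -/

theorem toLp_eta (x : E2) : !₂[x 0, x 1] = x := by
  ext i
  fin_cases i <;> simp

/-- The identification of `ℝ × ℝ` with the model plane. -/
def toPlane : ℝ × ℝ →L[ℝ] E2 :=
  (ContinuousLinearMap.fst ℝ ℝ ℝ).smulRight (EuclideanSpace.single 0 1) +
    (ContinuousLinearMap.snd ℝ ℝ ℝ).smulRight (EuclideanSpace.single 1 1)

theorem toPlane_apply (q : ℝ × ℝ) : toPlane q = !₂[q.1, q.2] := by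
  ext i
  fin_cases i <;> simp [toPlane]

/-- Two functions `t`, `s` whose differentials are diagonal along a pair of vector fields `X`, `Y`
are local coordinates, with coordinate vectors proportional to `X` and `Y`. -/
theorem exists_adapted_coordinates {Ω : Set E2} (hΩ : IsOpen Ω) {t s : E2 → ℝ}
    (ht : ContDiffOn ℝ ∞ t Ω) (hs : ContDiffOn ℝ ∞ s Ω) {X Y : E2 → E2}
    (htX : ∀ x ∈ Ω, fderiv ℝ t x (X x) ≠ 0) (htY : ∀ x ∈ Ω, fderiv ℝ t x (Y x) = 0)
    (hsX : ∀ x ∈ Ω, fderiv ℝ s x (X x) = 0) (hsY : ∀ x ∈ Ω, fderiv ℝ s x (Y x) ≠ 0)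
    {x₀ : E2} (hx₀ : x₀ ∈ Ω) :
    ∃ (ψ : OpenPartialHomeomorph E2 E2) (J K : Set ℝ) (γ : ℝ × ℝ → E2),
      x₀ ∈ ψ.source ∧ ψ.source ⊆ Ω ∧ ψ.target = {y | y 0 ∈ J ∧ y 1 ∈ K} ∧
      ContDiffOn ℝ ∞ ψ ψ.source ∧ ContDiffOn ℝ ∞ ψ.symm ψ.target ∧
      (∀ x ∈ ψ.source, x = γ (t x, s x)) ∧
      IsOpen J ∧ J.OrdConnected ∧ IsOpen K ∧ K.OrdConnected ∧ t x₀ ∈ J ∧ s x₀ ∈ K ∧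
      (∀ x, γ (x 0, x 1) = ψ.symm x) ∧ ContDiffOn ℝ ∞ γ (J ×ˢ K) ∧
      ∀ q ∈ J ×ˢ K, γ q ∈ Ω ∧ t (γ q) = q.1 ∧ s (γ q) = q.2 ∧
        fderiv ℝ γ q (1, 0) = (fderiv ℝ t (γ q) (X (γ q)))⁻¹ • X (γ q) ∧
        fderiv ℝ γ q (0, 1) = (fderiv ℝ s (γ q) (Y (γ q)))⁻¹ • Y (γ q) := by
  set H : E2 → E2 := fun x => !₂[t x, s x] with hH
  have hHs : ContDiffOn ℝ ∞ H Ω := by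
    rw [contDiffOn_euclidean]
    intro i
    fin_cases i
    · exact ht
    · exact hs
  have hHat : ∀ x ∈ Ω, ContDiffAt ℝ ∞ H x := fun x hx => hHs.contDiffAt (hΩ.mem_nhds hx)
  have hHd : ∀ x ∈ Ω, HasFDerivAt H (fderiv ℝ H x) x := fun x hx =>
    ((hHat x hx).differentiableAt (by simp)).hasFDerivAt
  have hval : ∀ x ∈ Ω, ∀ Z, fderiv ℝ H x Z = !₂[fderiv ℝ t x Z, fderiv ℝ s x Z] := by
    intro x hx Z
    have h := fun i : Fin 2 =>
      ((EuclideanSpace.proj (𝕜 := ℝ) i).hasFDerivAt.comp x (hHd x hx)).fderiv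
    have h0 : fderiv ℝ t x = _ := h 0
    have h1 : fderiv ℝ s x = _ := h 1
    rw [h0, h1]
    ext i
    fin_cases i <;> simp
  have hsurj : ∀ x ∈ Ω, Function.Surjective (fderiv ℝ H x) := by
    intro x hx y
    refine ⟨(y 0 * (fderiv ℝ t x (X x))⁻¹) • X x + (y 1 * (fderiv ℝ s x (Y x))⁻¹) • Y x, ?_⟩
    rw [hval x hx]
    ext i
    fin_cases i
    · simp [htY x hx, htX x hx]
    · simp [hsX x hx, hsY x hx]
  have hinj : ∀ x ∈ Ω, Function.Injective (fderiv ℝ H x) := fun x hx =>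
    (LinearMap.injective_iff_surjective (f := (fderiv ℝ H x : E2 →ₗ[ℝ] E2))).2 (hsurj x hx)
  have hequiv : ∀ x ∈ Ω, ∃ L : E2 ≃L[ℝ] E2, (L : E2 →L[ℝ] E2) = fderiv ℝ H x := by
    intro x hx
    refine ⟨ContinuousLinearEquiv.ofBijective (fderiv ℝ H x)
      (LinearMap.ker_eq_bot.2 (hinj x hx)) (LinearMap.range_eq_top.2 (hsurj x hx)), ?_⟩
    ext z
    simp
  obtain ⟨L₀, hL₀⟩ := hequiv x₀ hx₀
  have hd₀ : HasFDerivAt H (L₀ : E2 →L[ℝ] E2) x₀ := hL₀ ▸ hHd x₀ hx₀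
  set ψ₀ := (hHat x₀ hx₀).toOpenPartialHomeomorph H hd₀ (by simp) with hψ₀
  have hc₀ : ∀ x, ψ₀ x = H x := fun x => by
    rw [hψ₀, ContDiffAt.toOpenPartialHomeomorph_coe]
  set ψ₁ := ψ₀.restrOpen Ω hΩ with hψ₁
  have hx₁ : x₀ ∈ ψ₁.source :=
    ⟨(hHat x₀ hx₀).mem_toOpenPartialHomeomorph_source hd₀ (by simp), hx₀⟩
  have hc₁ : ∀ x, ψ₁ x = H x := hc₀
  have hs₁ : ψ₁.source ⊆ Ω := fun x hx => hx.2
  -- a coordinate box around the image of the base point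
  have hnhds : (toPlane ⁻¹' ψ₁.target) ∈ nhds ((t x₀, s x₀) : ℝ × ℝ) := by
    refine (ψ₁.open_target.preimage toPlane.continuous).mem_nhds ?_
    rw [Set.mem_preimage, toPlane_apply]
    have := ψ₁.map_source hx₁
    rwa [hc₁] at this
  obtain ⟨J, hJ, K, hK, hJK⟩ := mem_nhds_prod_iff.1 hnhds
  obtain ⟨δ, hδ, hJδ⟩ := Metric.mem_nhds_iff.1 hJ
  obtain ⟨ε, hε, hKε⟩ := Metric.mem_nhds_iff.1 hK
  set J' := Metric.ball (t x₀) δ with hJ'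
  set K' := Metric.ball (s x₀) ε with hK'
  set B : Set E2 := {y | y 0 ∈ J' ∧ y 1 ∈ K'} with hB
  have hBo : IsOpen B := by
    refine (Metric.isOpen_ball.preimage ?_).inter (Metric.isOpen_ball.preimage ?_)
    · fun_prop
    · fun_prop
  have hBt : B ⊆ ψ₁.target := by
    intro y hy
    have : (y 0, y 1) ∈ toPlane ⁻¹' ψ₁.target := hJK ⟨hJδ hy.1, hKε hy.2⟩
    rw [Set.mem_preimage, toPlane_apply] at this
    change !₂[y 0, y 1] ∈ _ at this
    rwa [toLp_eta] at this
  set ψ := (ψ₁.symm.restrOpen B hBo).symm with hψ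
  have htarget : ψ.target = B := by
    change ψ₁.target ∩ B = B
    exact Set.inter_eq_right.2 hBt
  have hcoe : ∀ x, ψ x = H x := hc₁
  have hsymm : ∀ y, ψ.symm y = ψ₁.symm y := fun _ => rfl
  have hsource : ∀ x, x ∈ ψ.source ↔ x ∈ ψ₁.source ∧ ψ₁ x ∈ B := by
    intro x
    change x ∈ (ψ₁.symm.restrOpen B hBo).target ↔ _
    rw [← OpenPartialHomeomorph.symm_source]
    constructor
    · intro hx
      have h1 := ψ.map_source hx
      rw [htarget] at h1
      have h2 : ψ₁.symm (ψ x) ∈ ψ₁.source := ψ₁.map_target (hBt h1)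
      rw [← hsymm, ψ.left_inv hx] at h2
      exact ⟨h2, h1⟩
    · rintro ⟨h1, h2⟩
      have h3 := ψ.map_target (htarget ▸ h2)
      rwa [hsymm, ψ₁.left_inv h1] at h3
  have hsΩ : ψ.source ⊆ Ω := fun x hx => hs₁ ((hsource x).1 hx).1
  have hsm : ContDiffOn ℝ ∞ ψ.symm ψ.target := by
    intro y hy
    have hy' := ψ.map_target hy
    obtain ⟨L, hL⟩ := hequiv _ (hsΩ hy')
    refine (ψ.contDiffAt_symm (f₀' := L) hy ?_ ?_).contDiffWithinAt
    · rw [hL]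
      exact hHd _ (hsΩ hy')
    · exact hHat _ (hsΩ hy')
  have hγs : ∀ q ∈ J' ×ˢ K', toPlane q ∈ ψ.target := by
    rintro ⟨u, v⟩ ⟨hu, hv⟩
    rw [htarget, toPlane_apply]
    exact ⟨hu, hv⟩
  have hγc : ContDiffOn ℝ ∞ (fun q => ψ.symm (toPlane q)) (J' ×ˢ K') :=
    hsm.comp toPlane.contDiff.contDiffOn hγs
  refine ⟨ψ, J', K', fun q => ψ.symm (toPlane q), ?_, hsΩ, htarget, ?_, hsm, ?_,
    Metric.isOpen_ball, ?_, Metric.isOpen_ball, ?_, Metric.mem_ball_self hδ,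
    Metric.mem_ball_self hε, ?_, hγc, ?_⟩
  · rw [hsource]
    refine ⟨hx₁, ?_⟩
    rw [hc₁]
    exact ⟨Metric.mem_ball_self hδ, Metric.mem_ball_self hε⟩
  · exact hHs.mono hsΩ
  · intro x hx
    have := ψ.left_inv hx
    rw [hcoe] at this
    change _ = ψ.symm (toPlane _)
    rw [toPlane_apply]
    exact this.symm
  · rw [hJ', Real.ball_eq_Ioo]
    exact Set.ordConnected_Ioo
  · rw [hK', Real.ball_eq_Ioo]
    exact Set.ordConnected_Ioo
  · intro x
    change ψ.symm (toPlane _) = _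
    rw [toPlane_apply]
    exact congrArg _ (toLp_eta x)
  · intro q hq
    have hqt := hγs q hq
    have hx := hsΩ (ψ.map_target hqt)
    have hr : H (ψ.symm (toPlane q)) = toPlane q := by
      rw [← hcoe]
      exact ψ.right_inv hqt
    have hev : (fun q => H (ψ.symm (toPlane q))) =ᶠ[nhds q] toPlane := by
      filter_upwards [(Metric.isOpen_ball.prod Metric.isOpen_ball).mem_nhds hq] with p hp
      rw [← hcoe]
      exact ψ.right_inv (hγs p hp)
    have hγd : DifferentiableAt ℝ (fun q => ψ.symm (toPlane q)) q :=
      (hγc.contDiffAt ((Metric.isOpen_ball.prod Metric.isOpen_ball).mem_nhds hq)).differentiableAt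
        (by simp)
    have hcomp : ∀ w, fderiv ℝ H (ψ.symm (toPlane q))
        (fderiv ℝ (fun q => ψ.symm (toPlane q)) q w) = toPlane w := by
      intro w
      have h1 := ((hHd _ hx).comp q hγd.hasFDerivAt).fderiv
      have h2 := hev.fderiv_eq (𝕜 := ℝ)
      rw [toPlane.fderiv] at h2
      have h3 := h1.symm.trans h2
      exact congrArg (fun l : ℝ × ℝ →L[ℝ] E2 => l w) h3
    refine ⟨hx, ?_, ?_, hinj _ hx ?_, hinj _ hx ?_⟩
    · have := congrArg (fun w : E2 => w 0) hr
      exact this.trans (by rw [toPlane_apply]; rfl)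
    · have := congrArg (fun w : E2 => w 1) hr
      exact this.trans (by rw [toPlane_apply]; rfl)
    · rw [hcomp, hval _ hx, toPlane_apply]
      ext i
      fin_cases i
      · simp [htX _ hx]
      · simp [hsX _ hx]
    · rw [hcomp, hval _ hx, toPlane_apply]
      ext i
      fin_cases i
      · simp [htY _ hx]
      · simp [hsY _ hx]

/-! ### Spherical frames -/

theorem eq_sum_inner_smul {a b c : E3} (ha : ‖a‖ = 1) (hb : ‖b‖ = 1) (hc : ‖c‖ = 1)
    (hab : inner ℝ a b = 0) (hac : inner ℝ a c = 0) (hbc : inner ℝ b c = 0) (x : E3) :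
    x = inner ℝ a x • a + inner ℝ b x • b + inner ℝ c x • c := by
  have ho : Orthonormal ℝ ![a, b, c] := by
    rw [orthonormal_iff_ite]
    intro i j
    fin_cases i <;> fin_cases j <;>
      simp [ha, hb, hc, hab, hac, hbc, real_inner_comm a,
        real_inner_comm b]
  obtain ⟨e, he⟩ := (ho.comp _ (Subtype.val_injective (p := (· ∈ Set.univ)))
    ).exists_orthonormalBasis_extension_of_card_eq (by simp)
  have h := (e.sum_repr' x).symm
  rw [Fin.sum_univ_three, he 0 trivial, he 1 trivial, he 2 trivial] at h
  exact h

section Frame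

variable {K : Set ℝ} {α n : ℝ → E3} {κ : ℝ → ℝ}

theorem hasDerivAt_of_contDiffOn {E : Type*} [NormedAddCommGroup E] [NormedSpace ℝ E]
    (hK : IsOpen K) {g : ℝ → E} (hg : ContDiffOn ℝ ∞ g K) {v : ℝ} (hv : v ∈ K) :
    HasDerivAt g (deriv g v) v :=
  ((hg.differentiableOn (by simp)).differentiableAt (hK.mem_nhds hv)).hasDerivAt

theorem contDiffOn_deriv {E : Type*} [NormedAddCommGroup E] [NormedSpace ℝ E]
    (hK : IsOpen K) {g : ℝ → E} (hg : ContDiffOn ℝ ∞ g K) : ContDiffOn ℝ ∞ (deriv g) K :=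
  ((contDiffOn_infty_iff_deriv_of_isOpen hK).1 hg).2

theorem inner_deriv_add_eq_zero (hK : IsOpen K) {g h : ℝ → E3} {c : ℝ} {g' h' : E3} {v : ℝ}
    (hv : v ∈ K) (hgh : ∀ w ∈ K, inner ℝ (g w) (h w) = c) (hg : HasDerivAt g g' v)
    (hh : HasDerivAt h h' v) : inner ℝ (g v) h' + inner ℝ g' (h v) = 0 := by
  have h1 := (hg.inner ℝ hh).deriv
  have h2 : (fun w => inner ℝ (g w) (h w)) =ᶠ[nhds v] fun _ => c := by
    filter_upwards [hK.mem_nhds hv] with w hw using hgh w hw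
  rw [h2.deriv_eq, deriv_const] at h1
  exact h1.symm

theorem inner_deriv_eq_zero_of_norm (hK : IsOpen K) {g : ℝ → E3} {v : ℝ}
    (hv : v ∈ K) (hg1 : ∀ w ∈ K, ‖g w‖ = 1) {g' : E3} (hg : HasDerivAt g g' v) :
    inner ℝ (g v) g' = 0 := by
  have h := inner_deriv_add_eq_zero hK hv (c := 1)
    (fun w hw => by rw [real_inner_self_eq_norm_sq, hg1 w hw, one_pow]) hg hg
  rw [real_inner_comm (g v) g'] at h
  linarith

variable (hK : IsOpen K) (hF : IsSphericalFrame K α n κ)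
include hK hF

theorem IsSphericalFrame.inner_deriv {v : ℝ} (hv : v ∈ K) : inner ℝ (α v) (deriv α v) = 0 :=
  inner_deriv_eq_zero_of_norm hK hv hF.sphere (hasDerivAt_of_contDiffOn hK hF.smooth hv)

theorem IsSphericalFrame.eq_sum {v : ℝ} (hv : v ∈ K) (x : E3) :
    x = inner ℝ (α v) x • α v + inner ℝ (deriv α v) x • deriv α v + inner ℝ (n v) x • n v :=
  eq_sum_inner_smul (hF.sphere v hv) (hF.unit_speed v hv) (hF.unit_normal v hv)
    (hF.inner_deriv hK hv) (hF.normal_pos v hv) (hF.normal_tangent v hv) x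

theorem IsSphericalFrame.hasDerivAt_tangent {v : ℝ} (hv : v ∈ K) :
    HasDerivAt (deriv α) (-α v + κ v • n v) v := by
  have hα := hasDerivAt_of_contDiffOn hK hF.smooth hv
  have hα' := hasDerivAt_of_contDiffOn hK (contDiffOn_deriv hK hF.smooth) hv
  refine hα'.congr_deriv ?_
  have h1 := inner_deriv_add_eq_zero hK hv (fun w hw => hF.inner_deriv hK hw) hα hα'
  rw [real_inner_self_eq_norm_sq, hF.unit_speed v hv] at h1
  have h2 := inner_deriv_eq_zero_of_norm hK hv hF.unit_speed hα'
  have h3 := hF.curvature v hv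
  rw [real_inner_comm] at h3
  rw [hF.eq_sum hK hv (deriv (deriv α) v), h2, ← h3, eq_neg_of_add_eq_zero_left h1]
  simp

theorem IsSphericalFrame.hasDerivAt_normal {v : ℝ} (hv : v ∈ K) :
    HasDerivAt n (-κ v • deriv α v) v := by
  have hα := hasDerivAt_of_contDiffOn hK hF.smooth hv
  have hα' := hasDerivAt_of_contDiffOn hK (contDiffOn_deriv hK hF.smooth) hv
  have hn := hasDerivAt_of_contDiffOn hK hF.smooth_normal hv
  refine hn.congr_deriv ?_
  have h1 := inner_deriv_add_eq_zero hK hv hF.normal_pos hα hn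
  have h2 := inner_deriv_add_eq_zero hK hv hF.normal_tangent hα' hn
  have h3 := inner_deriv_eq_zero_of_norm hK hv hF.unit_normal hn
  rw [hF.normal_tangent v hv, add_zero] at h1
  rw [← hF.curvature v hv] at h2
  rw [hF.eq_sum hK hv (deriv n v), h1, h3, eq_neg_of_add_eq_zero_left h2]
  simp

theorem IsSphericalFrame.contDiffOn_curvature : ContDiffOn ℝ ∞ κ K :=
  (((contDiffOn_deriv hK (contDiffOn_deriv hK hF.smooth)).inner ℝ hF.smooth_normal)).congr
    hF.curvature

end Frame

/-- A unit speed curve in the sphere has a spherical frame, with normal the cross product of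
position and velocity. -/
theorem exists_isSphericalFrame {K : Set ℝ} (hK : IsOpen K) {α : ℝ → E3}
    (hα : ContDiffOn ℝ ∞ α K) (h1 : ∀ v ∈ K, ‖α v‖ = 1) (h2 : ∀ v ∈ K, ‖deriv α v‖ = 1) :
    ∃ n κ, IsSphericalFrame K α n κ := by
  have hα' := contDiffOn_deriv hK hα
  refine ⟨fun v => WithLp.toLp 2 (crossProduct (α v).ofLp (deriv α v).ofLp), _,
    hα, ?_, h1, h2, ?_, ?_, ?_, fun v hv => rfl⟩
  · rw [contDiffOn_euclidean] at hα hα' ⊢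
    intro i
    fin_cases i
    · simp [cross_apply]
      exact ((hα 1).mul (hα' 2)).sub ((hα 2).mul (hα' 1))
    · simp [cross_apply]
      exact ((hα 2).mul (hα' 0)).sub ((hα 0).mul (hα' 2))
    · simp [cross_apply]
      exact ((hα 0).mul (hα' 1)).sub ((hα 1).mul (hα' 0))
  · intro v hv
    have e1 := h1 v hv
    have e2 := h2 v hv
    have e3 := inner_deriv_eq_zero_of_norm hK hv h1 (hasDerivAt_of_contDiffOn hK hα hv)
    rw [EuclideanSpace.norm_eq, Real.sqrt_eq_one] at e1 e2 ⊢
    simp only [Fin.sum_univ_three, Real.norm_eq_abs, sq_abs, cross_apply, PiLp.inner_apply,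
      RCLike.inner_apply, conj_trivial, Matrix.cons_val] at e1 e2 e3 ⊢
    linear_combination (deriv α v 0 ^ 2 + deriv α v 1 ^ 2 + deriv α v 2 ^ 2) * e1 + e2 -
      (α v 0 * deriv α v 0 + α v 1 * deriv α v 1 + α v 2 * deriv α v 2) * e3
  · intro v hv
    simp only [Fin.sum_univ_three, cross_apply, PiLp.inner_apply,
      RCLike.inner_apply, conj_trivial, Matrix.cons_val]
    ring
  · intro v hv
    simp only [Fin.sum_univ_three, cross_apply, PiLp.inner_apply,
      RCLike.inner_apply, conj_trivial, Matrix.cons_val]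
    ring

/-! ### Normal forms in adapted coordinates -/

theorem hasDerivAt_partial_fst {E : Type*} [NormedAddCommGroup E] [NormedSpace ℝ E]
    {ρ : ℝ × ℝ → E} {u v : ℝ} (h : DifferentiableAt ℝ ρ (u, v)) :
    HasDerivAt (fun w => ρ (w, v)) (fderiv ℝ ρ (u, v) (1, 0)) u :=
  h.hasFDerivAt.comp_hasDerivAt u ((hasDerivAt_id u).prodMk (hasDerivAt_const u v))

theorem hasDerivAt_partial_snd {E : Type*} [NormedAddCommGroup E] [NormedSpace ℝ E]
    {ρ : ℝ × ℝ → E} {u v : ℝ} (h : DifferentiableAt ℝ ρ (u, v)) :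
    HasDerivAt (fun w => ρ (u, w)) (fderiv ℝ ρ (u, v) (0, 1)) v :=
  h.hasFDerivAt.comp_hasDerivAt v ((hasDerivAt_const v u).prodMk (hasDerivAt_id v))

theorem contDiffOn_prodMk_left {E : Type*} [NormedAddCommGroup E] [NormedSpace ℝ E]
    {ρ : ℝ × ℝ → E} {J K : Set ℝ} (hρ : ContDiffOn ℝ ∞ ρ (J ×ˢ K)) {u : ℝ} (hu : u ∈ J) :
    ContDiffOn ℝ ∞ (fun v => ρ (u, v)) K :=
  hρ.comp (contDiff_const.prodMk contDiff_id).contDiffOn fun _ hv => ⟨hu, hv⟩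

theorem contDiffOn_prodMk_right {E : Type*} [NormedAddCommGroup E] [NormedSpace ℝ E]
    {ρ : ℝ × ℝ → E} {J K : Set ℝ} (hρ : ContDiffOn ℝ ∞ ρ (J ×ˢ K)) {v : ℝ} (hv : v ∈ K) :
    ContDiffOn ℝ ∞ (fun u => ρ (u, v)) J :=
  hρ.comp (contDiff_id.prodMk contDiff_const).contDiffOn fun _ hu => ⟨hu, hv⟩

section NormalForm

variable {I J K : Set ℝ} {f : ℝ → ℝ} (hJ : IsOpen J) (hJ' : J.OrdConnected) (hJI : J ⊆ I)
  (hK : IsOpen K) (hK' : K.OrdConnected) {v₀ : ℝ} (hv₀ : v₀ ∈ K)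
  {ρ : ℝ × ℝ → E3} (hρ : ContDiffOn ℝ ∞ ρ (J ×ˢ K))
  (hpos : ∀ q ∈ J ×ˢ K, 0 < -1 + f q.1 ^ 2 * ‖fderiv ℝ ρ q (1, 0)‖ ^ 2)
include hJ hJ' hJI hK hK' hv₀ hρ hpos

/-- If the level curves of the time function are straight lines in a fixed direction `w`, orthogonal
to the other coordinate curves, the surface is a cylinder. -/
theorem exists_isCylinder {w : E3} (hw : ‖w‖ = 1)
    (hv : ∀ q ∈ J ×ˢ K, fderiv ℝ ρ q (0, 1) = w)
    (hρw : ∀ q ∈ J ×ˢ K, inner ℝ w (ρ q) = q.2) :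
    ∃ (σ : ℝ → ℝ → Amb) (Φ : E3 ≃ᵃⁱ[ℝ] E3), IsCylinder I f J K σ ∧
      ∀ u ∈ J, ∀ v ∈ K, ((u, ρ (u, v)) : Amb) = ((σ u v).1, Φ (σ u v).2) := by
  have hd : ∀ q ∈ J ×ˢ K, DifferentiableAt ℝ ρ q := fun q hq =>
    (hρ.differentiableOn (by simp)).differentiableAt ((hJ.prod hK).mem_nhds hq)
  have ho : Orthonormal ℝ (({2} : Set (Fin 3)).domRestrict fun _ => w) := by
    constructor
    · intro i
      exact hw
    · rintro ⟨i, rfl⟩ ⟨j, rfl⟩ hij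
      exact absurd rfl hij
  obtain ⟨b, hb⟩ := ho.exists_orthonormalBasis_extension_of_card_eq (by simp)
  have hb2 : b 2 = w := hb 2 rfl
  set x : Fin 3 → ℝ → ℝ := fun i u => inner ℝ (b i) (ρ (u, v₀)) with hx
  have hxs : ∀ i, ContDiffOn ℝ ∞ (x i) J := fun i =>
    contDiffOn_const.inner ℝ (contDiffOn_prodMk_right hρ hv₀)
  have hxd : ∀ i, ∀ u ∈ J, deriv (x i) u = inner ℝ (b i) (fderiv ℝ ρ (u, v₀) (1, 0)) := by
    intro i u hu
    have := ((hasDerivAt_const u (b i)).inner ℝ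
      (hasDerivAt_partial_fst (hd (u, v₀) ⟨hu, hv₀⟩))).deriv
    simpa using this
  -- the component along the axis is the coordinate `v`
  have hx2 : ∀ u ∈ J, inner ℝ (b 2) (fderiv ℝ ρ (u, v₀) (1, 0)) = 0 := by
    intro u hu
    rw [← hxd 2 u hu]
    have : x 2 =ᶠ[nhds u] fun _ => v₀ := by
      filter_upwards [hJ.mem_nhds hu] with u' hu'
      rw [hx]
      simp only [hb2]
      exact hρw (u', v₀) ⟨hu', hv₀⟩
    rw [this.deriv_eq, deriv_const]
  have hval : ∀ u ∈ J, ∀ v ∈ K, ρ (u, v) = ρ (u, v₀) + (v - v₀) • w := by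
    intro u hu v hv'
    have hder : ∀ v ∈ K, HasDerivAt (fun v => ρ (u, v) - (v - v₀) • w) 0 v := by
      intro v hv'
      have h1 := hasDerivAt_partial_snd (hd (u, v) ⟨hu, hv'⟩)
      rw [hv (u, v) ⟨hu, hv'⟩] at h1
      have h2 := h1.sub (((hasDerivAt_id v).sub_const v₀).smul_const w)
      exact h2.congr_deriv (by simp)
    have := eq_of_hasDerivAt_eq_zero hK hK' hder hv' hv₀
    simp only [sub_self, zero_smul, sub_zero] at this
    rw [← this]
    abel
  refine ⟨fun u v => (u, !₂[x 0 u, x 1 u, v]), b.repr.symm.toAffineIsometryEquiv,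
    ⟨hJ, hJ', hJI, hK, hK', x 0, x 1, hxs 0, hxs 1, ?_, fun u _ v _ => rfl⟩, ?_⟩
  · intro u hu
    rw [hxd 0 u hu, hxd 1 u hu]
    have h1 := hpos (u, v₀) ⟨hu, hv₀⟩
    rw [← b.sum_sq_norm_inner_right, Fin.sum_univ_three, hx2 u hu] at h1
    simpa using h1
  · intro u hu v hv'
    refine Prod.ext rfl ?_
    simp only [LinearIsometryEquiv.coe_toAffineIsometryEquiv]
    rw [← b.sum_repr_symm, Fin.sum_univ_three, hval u hu v hv']
    conv_lhs => rw [← b.sum_repr' (ρ (u, v₀)), Fin.sum_univ_three]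
    have h2 : inner ℝ (b 2) (ρ (u, v₀)) = v₀ := by
      rw [hb2]
      exact hρw (u, v₀) ⟨hu, hv₀⟩
    rw [h2, hb2, sub_smul]
    simp [hx]

/-- If the level curves of the time function have direction `α(v)` at the points with second
coordinate `v`, for a unit speed spherical curve `α`, the surface is a frame surface. In the
orthonormal frame `α, α', n` the `u`-derivative of the surface has components `0, p, q`, and
`z = q + i p` satisfies `z_v = i κ z`; so the modulus of `z` depends on `u` only, and its argument
`τ` has `τ_v = κ`. -/
theorem isFrameSurface_of_direction {u₀ : ℝ} (hu₀ : u₀ ∈ J) {α : ℝ → E3} (hα : ContDiffOn ℝ ∞ α K)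
    (hα1 : ∀ v ∈ K, ‖α v‖ = 1) (hα2 : ∀ v ∈ K, ‖deriv α v‖ = 1) {m : ℝ × ℝ → ℝ}
    (hm : ∀ q ∈ J ×ˢ K, 0 < m q) (hv : ∀ q ∈ J ×ˢ K, fderiv ℝ ρ q (0, 1) = m q • α q.2)
    (hu : ∀ q ∈ J ×ˢ K, inner ℝ (α q.2) (fderiv ℝ ρ q (1, 0)) = 0) :
    IsFrameSurface I f J K fun u v => (u, ρ (u, v)) := by
  have hJK : IsOpen (J ×ˢ K) := hJ.prod hK
  have hρat : ∀ q ∈ J ×ˢ K, ContDiffAt ℝ ∞ ρ q := fun q hq => hρ.contDiffAt (hJK.mem_nhds hq)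
  have hd : ∀ q ∈ J ×ˢ K, DifferentiableAt ℝ ρ q := fun q hq =>
    (hρat q hq).differentiableAt (by simp)
  obtain ⟨n, κ, hF⟩ := exists_isSphericalFrame hK hα hα1 hα2
  have hα' := contDiffOn_deriv hK hα
  have hκ := hF.contDiffOn_curvature hK
  have dα := fun v (hv : v ∈ K) => hasDerivAt_of_contDiffOn hK hα hv
  have dα' := fun v (hv : v ∈ K) => hF.hasDerivAt_tangent hK hv
  have dn := fun v (hv : v ∈ K) => hF.hasDerivAt_normal hK hv
  have hvd : ∀ u ∈ J, ∀ v ∈ K, HasDerivAt (fun w => ρ (u, w)) (m (u, v) • α v) v := by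
    intro u hu v hv'
    rw [← hv (u, v) ⟨hu, hv'⟩]
    exact hasDerivAt_partial_snd (hd (u, v) ⟨hu, hv'⟩)
  have hud : ∀ u ∈ J, ∀ v ∈ K, HasDerivAt (fun w => ρ (w, v)) (fderiv ℝ ρ (u, v) (1, 0)) u :=
    fun u hu v hv' => hasDerivAt_partial_fst (hd (u, v) ⟨hu, hv'⟩)
  set ρu : ℝ × ℝ → E3 := fun q => fderiv ℝ ρ q (1, 0) with hρu
  have hρus : ContDiffOn ℝ ∞ ρu (J ×ˢ K) := fun q hq =>
    ((contDiffAt_fderiv (hρat q hq)).clm_apply contDiffAt_const).contDiffWithinAt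
  -- the mixed second derivative is proportional to `α`
  have hmix : ∀ u ∈ J, ∀ v ∈ K, ∃ c : ℝ, HasDerivAt (fun w => ρu (u, w)) (c • α v) v := by
    intro u hu' v hv'
    have hq : (u, v) ∈ J ×ˢ K := ⟨hu', hv'⟩
    have hdd : DifferentiableAt ℝ (fderiv ℝ ρ) (u, v) :=
      (contDiffAt_fderiv (hρat _ hq)).differentiableAt (by simp)
    have happ : ∀ w, HasFDerivAt (fun q => fderiv ℝ ρ q w)
        ((fderiv ℝ (fderiv ℝ ρ) (u, v)).flip w) (u, v) := fun w => by
      simpa using hdd.hasFDerivAt.clm_apply (hasFDerivAt_const w (u, v))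
    have h1 := hasDerivAt_partial_snd (happ (1, 0)).differentiableAt
    have h2 := hasDerivAt_partial_fst (happ (0, 1)).differentiableAt
    rw [(happ _).fderiv] at h1 h2
    have hsymm : fderiv ℝ (fderiv ℝ ρ) (u, v) (0, 1) (1, 0) =
        fderiv ℝ (fderiv ℝ ρ) (u, v) (1, 0) (0, 1) :=
      (hρat _ hq).isSymmSndFDerivAt (by rw [minSmoothness_of_isRCLikeNormedField]; norm_cast) _ _
    have h3 : HasDerivAt (fun w => inner ℝ (α v) (fderiv ℝ ρ (w, v) (0, 1)) • α v)
        (inner ℝ (α v) (fderiv ℝ (fderiv ℝ ρ) (u, v) (1, 0) (0, 1)) • α v) u := by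
      have := ((hasDerivAt_const u (α v)).inner ℝ h2).smul_const (α v)
      simpa using this
    have h4 : (fun w => inner ℝ (α v) (fderiv ℝ ρ (w, v) (0, 1)) • α v) =ᶠ[nhds u]
        fun w => fderiv ℝ ρ (w, v) (0, 1) := by
      filter_upwards [hJ.mem_nhds hu'] with w hw
      rw [hv (w, v) ⟨hw, hv'⟩, inner_smul_right, real_inner_self_eq_norm_sq, hα1 v hv']
      simp
    have h5 := (h3.congr_of_eventuallyEq h4.symm).unique h2
    refine ⟨_, h1.congr_deriv (Eq.trans ?_ h5.symm)⟩
    exact hsymm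
  set z : ℝ → ℝ → ℂ := fun u v =>
    (inner ℝ (n v) (ρu (u, v)) : ℝ) + (inner ℝ (deriv α v) (ρu (u, v)) : ℝ) * Complex.I with hz
  have hzd : ∀ u ∈ J, ∀ v ∈ K, HasDerivAt (z u) (κ v * Complex.I * z u v) v := by
    intro u hu' v hv'
    obtain ⟨c, hc⟩ := hmix u hu' v hv'
    have h1 := (((dn v hv').inner ℝ hc).ofReal_comp).add
      ((((dα' v hv').inner ℝ hc).ofReal_comp).mul_const Complex.I)
    refine h1.congr_deriv ?_
    have e1 : inner ℝ (n v) (α v) = 0 := by rw [real_inner_comm]; exact hF.normal_pos v hv'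
    have e2 : inner ℝ (deriv α v) (α v) = 0 := by
      rw [real_inner_comm]; exact hF.inner_deriv hK hv'
    have e3 : inner ℝ (α v) (ρu (u, v)) = 0 := hu (u, v) ⟨hu', hv'⟩
    simp only [hz, inner_add_left, inner_smul_left, inner_smul_right, inner_neg_left, e1, e2, e3,
      conj_trivial]
    push_cast
    linear_combination -(κ v * inner ℝ (deriv α v) (ρu (u, v)) : ℂ) * Complex.I_sq
  have hnorm : ∀ u ∈ J, ∀ v ∈ K, ‖ρu (u, v)‖ ^ 2 = ‖z u v‖ ^ 2 := by
    intro u hu' v hv'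
    have e3 : inner ℝ (α v) (ρu (u, v)) = 0 := hu (u, v) ⟨hu', hv'⟩
    have e4 := hF.eq_sum hK hv' (ρu (u, v))
    rw [e3, zero_smul, zero_add] at e4
    rw [← real_inner_self_eq_norm_sq]
    nth_rewrite 1 [e4]
    rw [inner_add_left, inner_smul_left, inner_smul_left, ← Complex.normSq_eq_norm_sq, hz,
      Complex.normSq_add_mul_I]
    simp only [conj_trivial]
    ring
  have hzs : ContDiffOn ℝ ∞ (fun u => z u v₀) J := by
    have h1 := contDiffOn_prodMk_right hρus hv₀
    have h2 : ContDiffOn ℝ ∞ (fun u => inner ℝ (n v₀) (ρu (u, v₀))) J :=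
      contDiffOn_const.inner ℝ h1
    have h3 : ContDiffOn ℝ ∞ (fun u => inner ℝ (deriv α v₀) (ρu (u, v₀))) J :=
      contDiffOn_const.inner ℝ h1
    exact (Complex.ofRealCLM.contDiff.comp_contDiffOn h2).add
      ((Complex.ofRealCLM.contDiff.comp_contDiffOn h3).mul contDiffOn_const)
  have hz0 : ∀ u ∈ J, z u v₀ ≠ 0 := by
    intro u hu' h0
    have h1 := hpos (u, v₀) ⟨hu', hv₀⟩
    have h2 := hnorm u hu' v₀ hv₀
    rw [h0] at h2
    change 0 < -1 + f u ^ 2 * ‖ρu (u, v₀)‖ ^ 2 at h1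
    rw [h2] at h1
    norm_num at h1
  obtain ⟨R, θ, hR, hθ, hzRθ⟩ := exists_polar hJ hJ' hzs hz0
  obtain ⟨A, hA0, hAs, hA⟩ := exists_contDiffOn_antiderivative hK hK' hκ v₀ hv₀
  have hzval : ∀ u ∈ J, ∀ v ∈ K, z u v = R u * Complex.exp ((θ u + A v : ℝ) * Complex.I) := by
    intro u hu' v hv'
    have hG : ∀ v ∈ K, HasDerivAt (fun v => (A v : ℂ) * Complex.I) (κ v * Complex.I) v :=
      fun v hv' => (hA v hv').ofReal_comp.mul_const Complex.I
    rw [eq_mul_exp_of_hasDerivAt hK hK' (hzd u hu') hG hv₀ (by simp [hA0]) hv', hzRθ u hu',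
      mul_assoc, ← Complex.exp_add]
    push_cast
    ring_nf
  have hq : ∀ u ∈ J, ∀ v ∈ K, inner ℝ (n v) (ρu (u, v)) = R u * Real.cos (θ u + A v) := by
    intro u hu' v hv'
    have := congrArg Complex.re (hzval u hu' v hv')
    rw [Complex.re_ofReal_mul, Complex.exp_ofReal_mul_I_re] at this
    simpa [hz] using this
  have hp : ∀ u ∈ J, ∀ v ∈ K, inner ℝ (deriv α v) (ρu (u, v)) = R u * Real.sin (θ u + A v) := by
    intro u hu' v hv'
    have := congrArg Complex.im (hzval u hu' v hv')
    rw [Complex.im_ofReal_mul, Complex.exp_ofReal_mul_I_im] at this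
    simpa [hz] using this
  have hconst : ∀ u ∈ J, ∀ v ∈ K, inner ℝ (α v) (ρ (u, v)) = inner ℝ (α v) (ρ (u₀, v)) := by
    intro u hu' v hv'
    refine eq_of_hasDerivAt_eq_zero hJ hJ' (g := fun u => inner ℝ (α v) (ρ (u, v))) ?_ hu' hu₀
    intro w hw
    refine ((hasDerivAt_const w (α v)).inner ℝ (hud w hw v hv')).congr_deriv ?_
    rw [inner_zero_left, add_zero]
    exact hu (w, v) ⟨hw, hv'⟩
  have hint : ∀ (c : ℝ → ℝ) (a : E3), ContinuousOn c J → ∀ v ∈ K,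
      (∀ u ∈ J, inner ℝ a (ρu (u, v)) = c u) → ∀ u ∈ J,
      inner ℝ a (ρ (u, v)) = (∫ ξ in u₀..u, c ξ) + inner ℝ a (ρ (u₀, v)) := by
    intro c a hc v hv' hac u hu'
    have hsub := hJ'.uIcc_subset hu₀ hu'
    rw [intervalIntegral.integral_eq_sub_of_hasDerivAt (f := fun w => inner ℝ a (ρ (w, v)))
      (fun w hw => ?_) (hc.mono hsub).intervalIntegrable]
    · ring
    · refine ((hasDerivAt_const w a).inner ℝ (hud w (hsub hw) v hv')).congr_deriv ?_
      rw [inner_zero_left, add_zero]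
      exact hac w (hsub hw)
  have hψ := contDiffOn_prodMk_left hρ hu₀
  refine ⟨hJ, hJ', hJI, hK, hK', α, n, κ, fun v => inner ℝ (α v) (ρ (u₀, v)),
    fun v => inner ℝ (deriv α v) (ρ (u₀, v)), fun v => inner ℝ (n v) (ρ (u₀, v)), R,
    fun u v => θ u + A v, fun u v => inner ℝ (deriv α v) (ρ (u, v)),
    fun u v => inner ℝ (n v) (ρ (u, v)), u₀, hF, hu₀, hα.inner ℝ hψ, hα'.inner ℝ hψ,
    hF.smooth_normal.inner ℝ hψ, hR, ?_, ?_, ?_, ?_, ?_, ?_, ?_, ?_, ?_⟩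
  · exact (hθ.comp contDiffOn_fst fun q hq => hq.1).add (hAs.comp contDiffOn_snd fun q hq => hq.2)
  · intro u _ v hv'
    exact ((hA v hv').const_add (θ u)).deriv
  · intro v hv'
    rw [((dα' v hv').inner ℝ (hvd u₀ hu₀ v hv')).deriv, inner_smul_right,
      real_inner_comm, hF.inner_deriv hK hv', inner_add_left, inner_neg_left, inner_smul_left]
    simp
    ring
  · intro v hv'
    rw [((dn v hv').inner ℝ (hvd u₀ hu₀ v hv')).deriv, inner_smul_right,
      real_inner_comm, hF.normal_pos v hv', inner_smul_left]
    simp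
  · intro u hu' v hv'
    refine hint (fun ξ => R ξ * Real.sin (θ ξ + A v)) _ ?_ v hv' (fun w hw => hp w hw v hv') u hu'
    exact hR.continuousOn.mul
      (Real.continuous_sin.comp_continuousOn (hθ.continuousOn.add continuousOn_const))
  · intro u hu' v hv'
    refine hint (fun ξ => R ξ * Real.cos (θ ξ + A v)) _ ?_ v hv' (fun w hw => hq w hw v hv') u hu'
    exact hR.continuousOn.mul
      (Real.continuous_cos.comp_continuousOn (hθ.continuousOn.add continuousOn_const))
  · intro u hu'
    have h1 := hpos (u, v₀) ⟨hu', hv₀⟩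
    change 0 < -1 + f u ^ 2 * ‖ρu (u, v₀)‖ ^ 2 at h1
    rw [hnorm u hu' v₀ hv₀, hzRθ u hu', norm_mul, Complex.norm_exp_ofReal_mul_I, mul_one,
      Complex.norm_real, Real.norm_eq_abs, sq_abs] at h1
    exact h1
  · intro u hu' v hv'
    have hev : (fun v => inner ℝ (α v) (ρ (u₀, v))) =ᶠ[nhds v]
        fun v => inner ℝ (α v) (ρ (u, v)) := by
      filter_upwards [hK.mem_nhds hv'] with w hw
      exact (hconst u hu' w hw).symm
    rw [hev.deriv_eq, ((dα v hv').inner ℝ (hvd u hu' v hv')).deriv, inner_smul_right,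
      real_inner_self_eq_norm_sq, hα1 v hv']
    simpa using hm (u, v) ⟨hu', hv'⟩
  · intro u hu' v hv'
    refine Prod.ext rfl ?_
    have := hF.eq_sum hK hv' (ρ (u, v))
    rwa [hconst u hu' v hv'] at this

end NormalForm

/-! ### The surfaces of the two families satisfy the principal direction condition -/

/-- The time component of `σ` is the first parameter, and the derivative of the space component in
the second parameter `v` is a nonzero multiple of a unit vector `a v`, on which the space component
has a product independent of the first parameter. -/
def HasRuledLevels (J K : Set ℝ) (σ : ℝ → ℝ → Amb) : Prop :=
  ∃ (a : ℝ → E3) (m : ℝ → ℝ → ℝ) (c : ℝ → ℝ), ∀ u ∈ J, ∀ v ∈ K, (σ u v).1 = u ∧ ‖a v‖ = 1 ∧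
    m u v ≠ 0 ∧ inner ℝ (a v) (σ u v).2 = c v ∧
    HasDerivAt (fun w => (σ u w).2) (m u v • a v) v

section RuledLevels

variable {I J K : Set ℝ} {f : ℝ → ℝ} {σ : ℝ → ℝ → Amb}

theorem IsCylinder.hasRuledLevels (h : IsCylinder I f J K σ) : HasRuledLevels J K σ := by
  obtain ⟨-, -, -, hK, -, x₁, x₂, -, -, -, hσ⟩ := h
  refine ⟨fun _ => EuclideanSpace.single 2 1, fun _ _ => 1, id, fun u hu v hv =>
    ⟨by rw [hσ u hu v hv], by simp, one_ne_zero, ?_, ?_⟩⟩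
  · rw [hσ u hu v hv, EuclideanSpace.inner_single_left]
    simp
  · have hev : (fun w => (σ u w).2) =ᶠ[nhds v] fun w : ℝ =>
        !₂[x₁ u, x₂ u, 0] + w • (EuclideanSpace.single 2 1 : E3) := by
      filter_upwards [hK.mem_nhds hv] with w hw
      rw [hσ u hu w hw]
      ext i
      fin_cases i <;> simp
    have h1 : HasDerivAt (fun w : ℝ => !₂[x₁ u, x₂ u, 0] +
        w • (EuclideanSpace.single 2 1 : E3)) ((1 : ℝ) • EuclideanSpace.single 2 1) v :=
      ((hasDerivAt_id v).smul_const _).const_add _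
    exact h1.congr_of_eventuallyEq hev

/-- For a frame surface the direction is `α v` and the factor is `φ₁' - φ₂`. The `v`-derivatives of
`φ₂` and `φ₃` need no differentiation under the integral sign: since `τ(ξ, w) - τ(ξ, v)` does not
depend on `ξ`, the integrals at `w` are rotations of the integrals at `v`. -/
theorem IsFrameSurface.hasRuledLevels (h : IsFrameSurface I f J K σ) : HasRuledLevels J K σ := by
  obtain ⟨hJ, hJ', -, hK, hK', α, n, κ, φ₁, ψ₁, ψ₂, R, τ, φ₂, φ₃, u₀, hF, hu₀, hφ₁, hψ₁, hψ₂, hR,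
    hτ, hτv, hψ₁', hψ₂', hφ₂, hφ₃, -, hm, hσ⟩ := h
  have dτ : ∀ u ∈ J, ∀ v ∈ K, HasDerivAt (τ u) (κ v) v := by
    intro u hu v hv
    rw [← hτv u hu v hv]
    exact hasDerivAt_of_contDiffOn hK (contDiffOn_prodMk_left hτ hu) hv
  refine ⟨α, fun u v => deriv φ₁ v - φ₂ u v, φ₁, fun u hu v hv =>
    ⟨by rw [hσ u hu v hv], hF.sphere v hv, (hm u hu v hv).ne', ?_, ?_⟩⟩
  · rw [hσ u hu v hv]
    simp [inner_add_right, inner_smul_right, hF.sphere v hv,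
      hF.inner_deriv hK hv, hF.normal_pos v hv]
  have hsub := hJ'.uIcc_subset hu₀ hu
  have hτc : ContinuousOn (fun ξ => τ ξ v) J := (contDiffOn_prodMk_right hτ hv).continuousOn
  have hS : IntervalIntegrable (fun ξ => R ξ * Real.sin (τ ξ v)) MeasureTheory.volume u₀ u :=
    ((hR.continuousOn.mul (Real.continuous_sin.comp_continuousOn hτc)).mono
      hsub).intervalIntegrable
  have hC : IntervalIntegrable (fun ξ => R ξ * Real.cos (τ ξ v)) MeasureTheory.volume u₀ u :=
    ((hR.continuousOn.mul (Real.continuous_cos.comp_continuousOn hτc)).mono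
      hsub).intervalIntegrable
  have hA : ∀ ξ ∈ J, ∀ w ∈ K, τ ξ w = τ ξ v + (τ u₀ w - τ u₀ v) := by
    intro ξ hξ w hw
    have := eq_of_hasDerivAt_eq_zero hK hK' (g := fun w => τ ξ w - τ u₀ w)
      (fun w hw => ((dτ ξ hξ w hw).sub (dτ u₀ hu₀ w hw)).congr_deriv (sub_self _)) hw hv
    linarith
  have dA : HasDerivAt (fun w => τ u₀ w - τ u₀ v) (κ v) v := (dτ u₀ hu₀ v hv).sub_const _
  have dψ₁ := hasDerivAt_of_contDiffOn hK hψ₁ hv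
  have dψ₂ := hasDerivAt_of_contDiffOn hK hψ₂ hv
  rw [hψ₁' v hv] at dψ₁
  rw [hψ₂' v hv] at dψ₂
  have dφ₂ : HasDerivAt (φ₂ u) (κ v * φ₃ u v - φ₁ v) v := by
    have hev : φ₂ u =ᶠ[nhds v] fun w =>
        (Real.cos (τ u₀ w - τ u₀ v) * (∫ ξ in u₀..u, R ξ * Real.sin (τ ξ v)) +
          Real.sin (τ u₀ w - τ u₀ v) * ∫ ξ in u₀..u, R ξ * Real.cos (τ ξ v)) + ψ₁ w := by
      filter_upwards [hK.mem_nhds hv] with w hw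
      rw [hφ₂ u hu w hw, ← intervalIntegral.integral_const_mul,
        ← intervalIntegral.integral_const_mul,
        ← intervalIntegral.integral_add (hS.const_mul _) (hC.const_mul _)]
      congr 1
      refine intervalIntegral.integral_congr fun ξ hξ => ?_
      simp only [hA ξ (hsub hξ) w hw, Real.sin_add]
      ring
    have := ((dA.cos.mul_const (∫ ξ in u₀..u, R ξ * Real.sin (τ ξ v))).add
      (dA.sin.mul_const (∫ ξ in u₀..u, R ξ * Real.cos (τ ξ v)))).add dψ₁
    refine (this.congr_of_eventuallyEq hev).congr_deriv ?_
    rw [hφ₃ u hu v hv]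
    simp
    ring
  have dφ₃ : HasDerivAt (φ₃ u) (-(κ v * φ₂ u v)) v := by
    have hev : φ₃ u =ᶠ[nhds v] fun w =>
        (Real.cos (τ u₀ w - τ u₀ v) * (∫ ξ in u₀..u, R ξ * Real.cos (τ ξ v)) -
          Real.sin (τ u₀ w - τ u₀ v) * ∫ ξ in u₀..u, R ξ * Real.sin (τ ξ v)) + ψ₂ w := by
      filter_upwards [hK.mem_nhds hv] with w hw
      rw [hφ₃ u hu w hw, ← intervalIntegral.integral_const_mul,
        ← intervalIntegral.integral_const_mul,
        ← intervalIntegral.integral_sub (hC.const_mul _) (hS.const_mul _)]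
      congr 1
      refine intervalIntegral.integral_congr fun ξ hξ => ?_
      simp only [hA ξ (hsub hξ) w hw, Real.cos_add]
      ring
    have := ((dA.cos.mul_const (∫ ξ in u₀..u, R ξ * Real.cos (τ ξ v))).sub
      (dA.sin.mul_const (∫ ξ in u₀..u, R ξ * Real.sin (τ ξ v)))).add dψ₂
    refine (this.congr_of_eventuallyEq hev).congr_deriv ?_
    rw [hφ₂ u hu v hv]
    simp
    ring
  have hev : (fun w => (σ u w).2) =ᶠ[nhds v]
      fun w => φ₁ w • α w + φ₂ u w • deriv α w + φ₃ u w • n w := by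
    filter_upwards [hK.mem_nhds hv] with w hw
    rw [hσ u hu w hw]
  have hd := (((hasDerivAt_of_contDiffOn hK hφ₁ hv).smul (hasDerivAt_of_contDiffOn hK hF.smooth hv)
    ).add (dφ₂.smul (hF.hasDerivAt_tangent hK hv))).add (dφ₃.smul (hF.hasDerivAt_normal hK hv))
  refine (HasDerivAt.congr_of_eventuallyEq hd hev).congr_deriv ?_
  module

theorem hasDerivAt_line {E : Type*} [NormedAddCommGroup E] [NormedSpace ℝ E] {G : E2 → E} {x : E2}
    (hG : DifferentiableAt ℝ G x) (e : E2) :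
    HasDerivAt (fun r : ℝ => G (x + r • e)) (fderiv ℝ G x e) 0 := by
  have h1 : HasDerivAt (fun r : ℝ => x + r • e) e 0 := by
    simpa using ((hasDerivAt_id (0 : ℝ)).smul_const e).const_add x
  exact HasFDerivAt.comp_hasDerivAt (0 : ℝ) (by simpa using hG.hasFDerivAt) h1

/-- If the velocity of the level curves of the time component has a direction `a` depending on the
second coordinate only, and orthogonal to the first coordinate curves, the principal direction
condition holds. -/
theorem isPrincipalAt_of_hasRuledLevels (hσ : HasRuledLevels J K σ) (Φ : E3 ≃ᵃⁱ[ℝ] E3)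
    {G : E2 → Amb} {B : Set E2} (hB : IsOpen B) (hG : ContDiffOn ℝ ∞ G B)
    (hBG : ∀ y ∈ B, y 0 ∈ J ∧ y 1 ∈ K ∧
      G y = ((σ (y 0) (y 1)).1, Φ (σ (y 0) (y 1)).2)) {x : E2} (hx : x ∈ B) :
    IsPrincipalAt G x := by
  obtain ⟨a, m, c, h⟩ := hσ
  set Λ := Φ.linearIsometryEquiv with hΛ
  have hΦ : ∀ w, Φ w = Λ w + Φ 0 := fun w => by
    have := Φ.map_vadd 0 w
    simpa using this
  set e₀ : E2 := EuclideanSpace.single 0 1 with he₀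
  set e₁ : E2 := EuclideanSpace.single 1 1 with he₁
  have hGat : ∀ y ∈ B, ContDiffAt ℝ ∞ G y := fun y hy => hG.contDiffAt (hB.mem_nhds hy)
  have hGd : ∀ y ∈ B, DifferentiableAt ℝ G y := fun y hy => (hGat y hy).differentiableAt (by simp)
  have hline : ∀ (y e : E2), y ∈ B → ∀ᶠ r : ℝ in nhds 0, y + r • e ∈ B := by
    intro y e hy
    have hc : ContinuousAt (fun r : ℝ => y + r • e) 0 := by fun_prop
    exact hc.eventually (hB.mem_nhds (by simpa using hy))
  have hfst : ∀ Y, (fderiv ℝ G x Y).1 = Y 0 := by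
    intro Y
    have h1 : HasDerivAt (fun r : ℝ => (G (x + r • Y)).1) (fderiv ℝ G x Y).1 0 :=
      (ContinuousLinearMap.fst ℝ ℝ E3).hasFDerivAt.comp_hasDerivAt (0 : ℝ)
        (hasDerivAt_line (hGd x hx) Y)
    have h2 : HasDerivAt (fun r : ℝ => x 0 + r * Y 0) (Y 0) 0 := by
      simpa using ((hasDerivAt_id (0 : ℝ)).mul_const (Y 0)).const_add (x 0)
    refine h1.unique (h2.congr_of_eventuallyEq ?_)
    filter_upwards [hline x Y hx] with r hr
    obtain ⟨hu, hv, e⟩ := hBG _ hr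
    rw [e, (h _ hu _ hv).1]
    simp
  have he1 : ∀ y ∈ B, fderiv ℝ G y e₁ = (0, m (y 0) (y 1) • Λ (a (y 1))) := by
    intro y hy
    obtain ⟨hu, hv, -⟩ := hBG y hy
    have h1 := hasDerivAt_line (hGd y hy) e₁
    have h2 := (h _ hu _ hv).2.2.2.2
    have h3 : HasDerivAt (fun r : ℝ => y 1 + r) 1 0 := by
      simpa using (hasDerivAt_id (0 : ℝ)).const_add (y 1)
    have h4 : HasDerivAt (fun r : ℝ => (σ (y 0) (y 1 + r)).2) (m (y 0) (y 1) • a (y 1)) 0 := by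
      have := HasDerivAt.scomp (0 : ℝ) (h := fun r : ℝ => y 1 + r) (by simpa using h2) h3
      exact this.congr_deriv (one_smul _ _)
    have h5 : HasDerivAt (fun r : ℝ => Λ (σ (y 0) (y 1 + r)).2 + Φ 0)
        (Λ (m (y 0) (y 1) • a (y 1))) 0 :=
      (Λ.toContinuousLinearEquiv.toContinuousLinearMap.hasFDerivAt.comp_hasDerivAt (0 : ℝ)
        h4).add_const _
    rw [map_smul] at h5
    refine h1.unique (((hasDerivAt_const (0 : ℝ) (y 0)).prodMk h5).congr_of_eventuallyEq ?_)
    filter_upwards [hline y e₁ hy] with r hr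
    obtain ⟨hu', hv', e⟩ := hBG _ hr
    rw [e, (h _ hu' _ hv').1, hΦ]
    simp [he₁]
  obtain ⟨hu, hv, -⟩ := hBG x hx
  obtain ⟨-, ha, hm0, -, -⟩ := h _ hu _ hv
  have hΛa : ‖Λ (a (x 1))‖ = 1 := by rw [Λ.norm_map, ha]
  have horth : inner ℝ (Λ (a (x 1))) (fderiv ℝ G x e₀).2 = 0 := by
    have h1 := (hasDerivAt_const (0 : ℝ) (Λ (a (x 1)))).inner ℝ
      (((hasDerivAt_line (hGd x hx) e₀).snd).sub_const (Φ 0))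
    have hev : (fun r : ℝ => inner ℝ (Λ (a (x 1))) ((G (x + r • e₀)).2 - Φ 0)) =ᶠ[nhds 0]
        fun _ => c (x 1) := by
      filter_upwards [hline x e₀ hx] with r hr
      obtain ⟨hu', hv', e⟩ := hBG _ hr
      have e1 : (x + r • e₀) 1 = x 1 := by simp [he₀]
      rw [e1] at hv' e
      have := (h _ hu' _ hv').2.2.2.1
      rw [e, hΦ, add_sub_cancel_right, Λ.inner_map_map, this]
    have h2 := h1.unique ((hasDerivAt_const (0 : ℝ) (c (x 1))).congr_of_eventuallyEq hev)
    simpa using h2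
  intro X Y hY hXY
  rw [hfst] at hY
  have hYe : Y = Y 1 • e₁ := by
    conv_lhs => rw [eq_smul_single_add Y, hY, zero_smul, zero_add]
  by_cases hY1 : Y 1 = 0
  · refine ⟨0, ?_⟩
    rw [hYe, hY1]
    simp
  have hXe : X = X 0 • e₀ + X 1 • e₁ := eq_smul_single_add X
  have hX1 : X 1 = 0 := by
    rw [hYe, map_smul, he1 x hx, hXe, map_add, map_smul, map_smul, he1 x hx] at hXY
    simp only [Prod.smul_snd, Prod.snd_add, inner_add_left, inner_smul_left, inner_smul_right,
      real_inner_self_eq_norm_sq, hΛa, conj_trivial] at hXY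
    rw [real_inner_comm] at horth
    rw [horth] at hXY
    simpa [hY1, hm0] using hXY
  rw [hX1, zero_smul, add_zero] at hXe
  -- along the first coordinate curve the derivative in the second coordinate keeps its direction
  have hVd : DifferentiableAt ℝ (fun y => fderiv ℝ G y e₁) x :=
    ((contDiffAt_fderiv (hGat x hx)).clm_apply contDiffAt_const).differentiableAt (by simp)
  have h1 := hasDerivAt_line hVd e₀
  set V' := fderiv ℝ (fun y => fderiv ℝ G y e₁) x e₀ with hV'
  have h2 : V' = (0, inner ℝ (Λ (a (x 1))) V'.2 • Λ (a (x 1))) := by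
    have h3 : HasDerivAt (fun r : ℝ => ((0 : ℝ), inner ℝ (Λ (a (x 1)))
        (fderiv ℝ G (x + r • e₀) e₁).2 • Λ (a (x 1))))
        (0, inner ℝ (Λ (a (x 1))) V'.2 • Λ (a (x 1))) 0 := by
      have := ((hasDerivAt_const (0 : ℝ) (Λ (a (x 1)))).inner ℝ h1.snd).smul_const (Λ (a (x 1)))
      rw [inner_zero_left, add_zero] at this
      exact (hasDerivAt_const (0 : ℝ) (0 : ℝ)).prodMk this
    refine h1.unique (h3.congr_of_eventuallyEq ?_)
    filter_upwards [hline x e₀ hx] with r hr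
    have e1 : (x + r • e₀) 1 = x 1 := by simp [he₀]
    rw [he1 _ hr, e1, inner_smul_right, real_inner_self_eq_norm_sq, hΛa]
    simp
  have h3 : fderiv ℝ (fun y => fderiv ℝ G y Y) x X = (Y 1 * X 0) • V' := by
    have e : (fun y => fderiv ℝ G y Y) = Y 1 • fun y => fderiv ℝ G y e₁ := by
      funext y
      conv_lhs => rw [hYe]
      simp
    rw [e, fderiv_const_smul hVd]
    conv_lhs => rw [hXe]
    simp [smul_smul, hV', mul_comm]
  refine ⟨(Y 1 * X 0 * inner ℝ (Λ (a (x 1))) V'.2 / m (x 0) (x 1)) • e₁, ?_⟩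
  rw [h3, map_smul, he1 x hx]
  conv_lhs => rw [h2]
  ext1
  · simp
  · simp only [Prod.smul_snd, smul_smul]
    congr 1
    field_simp

end RuledLevels

/-! ### Local classification -/

theorem fderiv_fst_eq_timeForm {F : E2 → Amb} {x : E2} (hF : DifferentiableAt ℝ F x) :
    fderiv ℝ (fun y => (F y).1) x = timeForm F x :=
  hF.hasFDerivAt.fst.fderiv

/-- The local expression `F` of a surface on the open set `Ω` is spacelike, has its time component
regular with values in `I`, and satisfies the principal direction condition. -/
structure IsPrincipalOn (I : Set ℝ) (f : ℝ → ℝ) (F : E2 → Amb) (Ω : Set E2) : Prop where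
  isOpen : IsOpen Ω
  smooth : ContDiffOn ℝ ∞ F Ω
  mem : ∀ x ∈ Ω, (F x).1 ∈ I
  spacelike : ∀ x ∈ Ω, IsSpacelikeAt f F x
  regular : ∀ x ∈ Ω, timeForm F x ≠ 0
  principal : ∀ x ∈ Ω, IsPrincipalAt F x

/-- `F` is congruent near `x` to a surface of one of the two families, in coordinates `ψ` on the
model plane. -/
def IsLocallyCongruent (I : Set ℝ) (f : ℝ → ℝ) (F : E2 → Amb) (Ω : Set E2) (x : E2) : Prop :=
  ∃ (ψ : OpenPartialHomeomorph E2 E2) (J K : Set ℝ) (σ : ℝ → ℝ → Amb) (Φ : E3 ≃ᵃⁱ[ℝ] E3),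
    x ∈ ψ.source ∧ ψ.source ⊆ Ω ∧ ContDiffOn ℝ ∞ ψ ψ.source ∧ ContDiffOn ℝ ∞ ψ.symm ψ.target ∧
    (IsCylinder I f J K σ ∨ IsFrameSurface I f J K σ) ∧
    ∀ y ∈ ψ.target, y 0 ∈ J ∧ y 1 ∈ K ∧
      F (ψ.symm y) = ((σ (y 0) (y 1)).1, Φ (σ (y 0) (y 1)).2)

/-- The time component of `F` and the function `s` are the coordinates `ψ`, with image the box
`J × K`, and `γ` is the inverse parametrization. The level curves of the time component and of `s`
are orthogonal. -/
structure IsAdaptedChart (I : Set ℝ) (f : ℝ → ℝ) (F : E2 → Amb) (Ω : Set E2) (s : E2 → ℝ)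
    (ψ : OpenPartialHomeomorph E2 E2) (J K : Set ℝ) (γ : ℝ × ℝ → E2) : Prop where
  source_subset : ψ.source ⊆ Ω
  target_eq : ψ.target = {y | y 0 ∈ J ∧ y 1 ∈ K}
  contDiffOn : ContDiffOn ℝ ∞ ψ ψ.source
  contDiffOn_symm : ContDiffOn ℝ ∞ ψ.symm ψ.target
  eq_param : ∀ x ∈ ψ.source, x = γ ((F x).1, s x)
  isOpen_fst : IsOpen J
  ordConnected_fst : J.OrdConnected
  fst_subset : J ⊆ I
  isOpen_snd : IsOpen K
  ordConnected_snd : K.OrdConnected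
  param_eq : ∀ x, γ (x 0, x 1) = ψ.symm x
  contDiffOn_param : ContDiffOn ℝ ∞ γ (J ×ˢ K)
  mem : ∀ q ∈ J ×ˢ K, γ q ∈ Ω
  time : ∀ q ∈ J ×ˢ K, (F (γ q)).1 = q.1
  snd : ∀ q ∈ J ×ˢ K, s (γ q) = q.2
  deriv_fst : ∀ q ∈ J ×ˢ K, fderiv ℝ γ q (1, 0) =
    (timeForm F (γ q) (orthVec F (γ q)))⁻¹ • orthVec F (γ q)
  deriv_snd : ∀ q ∈ J ×ˢ K, fderiv ℝ γ q (0, 1) =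
    (fderiv ℝ s (γ q) (levelVec F (γ q)))⁻¹ • levelVec F (γ q)
  snd_levelVec_pos : ∀ q ∈ J ×ˢ K, 0 < fderiv ℝ s (γ q) (levelVec F (γ q))

section Local

variable {I : Set ℝ} {f : ℝ → ℝ} {F : E2 → Amb} {Ω : Set E2}

namespace IsPrincipalOn

variable (h : IsPrincipalOn I f F Ω)
include h

theorem mono {Ω' : Set E2} (hΩ' : IsOpen Ω') (hs : Ω' ⊆ Ω) : IsPrincipalOn I f F Ω' :=
  ⟨hΩ', h.smooth.mono hs, fun x hx => h.mem x (hs hx), fun x hx => h.spacelike x (hs hx),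
    fun x hx => h.regular x (hs hx), fun x hx => h.principal x (hs hx)⟩

theorem contDiffAt {x : E2} (hx : x ∈ Ω) : ContDiffAt ℝ ∞ F x :=
  h.smooth.contDiffAt (h.isOpen.mem_nhds hx)

theorem differentiableAt {x : E2} (hx : x ∈ Ω) : DifferentiableAt ℝ F x :=
  (h.contDiffAt hx).differentiableAt (by simp)

theorem levelVel_ne {x : E2} (hx : x ∈ Ω) : levelVel F x ≠ 0 :=
  levelVel_ne_zero (h.spacelike x hx) (h.regular x hx)

theorem contDiffAt_dir {x : E2} (hx : x ∈ Ω) : ContDiffAt ℝ ∞ (levelDir F) x :=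
  contDiffAt_levelDir (h.contDiffAt hx) (h.levelVel_ne hx)

theorem hasFDerivAt_dir {x : E2} (hx : x ∈ Ω) :
    HasFDerivAt (levelDir F) (fderiv ℝ (levelDir F) x) x :=
  ((h.contDiffAt_dir hx).differentiableAt (by simp)).hasFDerivAt

theorem contDiffOn_dir : ContDiffOn ℝ ∞ (levelDir F) Ω :=
  fun _ hx => (h.contDiffAt_dir hx).contDiffWithinAt

theorem fderiv_dir_orthVec {x : E2} (hx : x ∈ Ω) : fderiv ℝ (levelDir F) x (orthVec F x) = 0 :=
  (isPrincipalAt_iff_fderiv_levelDir (h.contDiffAt hx) (h.regular x hx) (h.levelVel_ne hx)).1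
    (h.principal x hx)

theorem exists_isAdaptedChart {s : E2 → ℝ} (hs : ContDiffOn ℝ ∞ s Ω)
    (hsX : ∀ x ∈ Ω, fderiv ℝ s x (orthVec F x) = 0)
    (hsY : ∀ x ∈ Ω, 0 < fderiv ℝ s x (levelVec F x)) {x₀ : E2} (hx₀ : x₀ ∈ Ω) :
    ∃ ψ J K γ, IsAdaptedChart I f F Ω s ψ J K γ ∧ x₀ ∈ ψ.source ∧ (F x₀).1 ∈ J ∧ s x₀ ∈ K := by
  have hft := fun x (hx : x ∈ Ω) => fderiv_fst_eq_timeForm (h.differentiableAt hx)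
  obtain ⟨ψ, J, K, γ, h1, h2, h3, h4, h5, h6, h7, h8, h9, h10, h11, h12, h13, h14, h15⟩ :=
    exists_adapted_coordinates h.isOpen (t := fun x => (F x).1) h.smooth.fst hs
    (X := orthVec F) (Y := levelVec F)
    (fun x hx => by
      rw [hft x hx]
      exact timeForm_orthVec_ne_zero (h.levelVel_ne hx) (h.regular x hx))
    (fun x hx => by
      rw [hft x hx]
      exact fst_levelVec F x)
    hsX (fun x hx => (hsY x hx).ne') hx₀
  refine ⟨ψ, J, K, γ, ⟨h2, h3, h4, h5, h6, h7, h8, ?_, h9, h10, h13, h14,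
    fun q hq => (h15 q hq).1, fun q hq => (h15 q hq).2.1, fun q hq => (h15 q hq).2.2.1, ?_,
    fun q hq => (h15 q hq).2.2.2.2, fun q hq => hsY _ (h15 q hq).1⟩, h1, h11, h12⟩
  · intro u hu
    have h16 := h15 (u, s x₀) ⟨hu, h12⟩
    have := h.mem _ h16.1
    rwa [h16.2.1] at this
  · intro q hq
    rw [(h15 q hq).2.2.2.1, hft _ (h15 q hq).1]

end IsPrincipalOn

namespace IsAdaptedChart

variable {s : E2 → ℝ} {ψ : OpenPartialHomeomorph E2 E2} {J K : Set ℝ} {γ : ℝ × ℝ → E2}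
  (hc : IsAdaptedChart I f F Ω s ψ J K γ) (h : IsPrincipalOn I f F Ω)
include hc

theorem hasFDerivAt_param {q : ℝ × ℝ} (hq : q ∈ J ×ˢ K) : HasFDerivAt γ (fderiv ℝ γ q) q :=
  ((hc.contDiffOn_param.contDiffAt ((hc.isOpen_fst.prod hc.isOpen_snd).mem_nhds hq)
    ).differentiableAt (by simp)).hasFDerivAt

include h

theorem contDiffOn_space : ContDiffOn ℝ ∞ (fun q => (F (γ q)).2) (J ×ˢ K) :=
  (h.smooth.comp hc.contDiffOn_param hc.mem).snd

theorem fderiv_space {q : ℝ × ℝ} (hq : q ∈ J ×ˢ K) (w : ℝ × ℝ) :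
    fderiv ℝ (fun q => (F (γ q)).2) q w = (fderiv ℝ F (γ q) (fderiv ℝ γ q w)).2 := by
  have := ((h.differentiableAt (hc.mem q hq)).hasFDerivAt.comp q (hc.hasFDerivAt_param hq)).snd
  have e : fderiv ℝ (fun q => (F (γ q)).2) q = _ := this.fderiv
  rw [e]
  rfl

theorem fderiv_space_snd {q : ℝ × ℝ} (hq : q ∈ J ×ˢ K) :
    fderiv ℝ (fun q => (F (γ q)).2) q (0, 1) =
      ((fderiv ℝ s (γ q) (levelVec F (γ q)))⁻¹ * ‖levelVel F (γ q)‖) • levelDir F (γ q) := by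
  rw [hc.fderiv_space h hq, hc.deriv_snd q hq, map_smul, mul_smul, ← levelVel_eq_smul_levelDir]
  rfl

theorem inner_dir_fderiv_space_fst {q : ℝ × ℝ} (hq : q ∈ J ×ˢ K) :
    inner ℝ (levelDir F (γ q)) (fderiv ℝ (fun q => (F (γ q)).2) q (1, 0)) = 0 := by
  rw [hc.fderiv_space h hq, hc.deriv_fst q hq, map_smul, levelDir, Prod.smul_snd,
    inner_smul_left, inner_smul_right, inner_levelVel_orthVec]
  simp

theorem spacelike_fst {q : ℝ × ℝ} (hq : q ∈ J ×ˢ K) :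
    0 < -1 + f q.1 ^ 2 * ‖fderiv ℝ (fun q => (F (γ q)).2) q (1, 0)‖ ^ 2 := by
  have hx := hc.mem q hq
  have h1 : (fderiv ℝ F (γ q) (fderiv ℝ γ q (1, 0))).1 = 1 := by
    rw [hc.deriv_fst q hq, map_smul, Prod.smul_fst, smul_eq_mul]
    exact inv_mul_cancel₀ (timeForm_orthVec_ne_zero (h.levelVel_ne hx) (h.regular _ hx))
  have h2 : fderiv ℝ γ q (1, 0) ≠ 0 := by
    intro h0
    rw [h0, map_zero] at h1
    exact zero_ne_one h1
  have h3 := h.spacelike _ hx _ h2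
  rw [metric, h1, hc.time q hq, real_inner_self_eq_norm_sq] at h3
  rw [hc.fderiv_space h hq]
  simpa using h3

theorem fderiv_dir {q : ℝ × ℝ} (hq : q ∈ J ×ˢ K) (w : ℝ × ℝ) :
    fderiv ℝ (fun q => levelDir F (γ q)) q w =
      fderiv ℝ (levelDir F) (γ q) (fderiv ℝ γ q w) := by
  have := ((h.hasFDerivAt_dir (hc.mem q hq)).comp q (hc.hasFDerivAt_param hq)).fderiv
  have e : fderiv ℝ (fun q => levelDir F (γ q)) q = _ := this
  rw [e]
  rfl

theorem contDiffOn_dir_param : ContDiffOn ℝ ∞ (fun q => levelDir F (γ q)) (J ×ˢ K) :=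
  h.contDiffOn_dir.comp hc.contDiffOn_param hc.mem

theorem differentiableAt_dir_param {q : ℝ × ℝ} (hq : q ∈ J ×ˢ K) :
    DifferentiableAt ℝ (fun q => levelDir F (γ q)) q :=
  ((hc.contDiffOn_dir_param h).differentiableOn (by simp)).differentiableAt
    ((hc.isOpen_fst.prod hc.isOpen_snd).mem_nhds hq)

/-- The direction of the level curves depends on the second coordinate only. -/
theorem dir_eq {u u' v : ℝ} (hu : u ∈ J) (hu' : u' ∈ J) (hv : v ∈ K) :
    levelDir F (γ (u, v)) = levelDir F (γ (u', v)) := by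
  refine eq_of_hasDerivAt_eq_zero hc.isOpen_fst hc.ordConnected_fst
    (g := fun u => levelDir F (γ (u, v))) (fun w hw => ?_) hu hu'
  have hq : (w, v) ∈ J ×ˢ K := ⟨hw, hv⟩
  refine (hasDerivAt_partial_fst (ρ := fun q => levelDir F (γ q))
    (hc.differentiableAt_dir_param h hq)).congr_deriv ?_
  rw [hc.fderiv_dir h hq, hc.deriv_fst _ hq, map_smul, h.fderiv_dir_orthVec (hc.mem _ hq),
    smul_zero]

theorem hasDerivAt_dir {u v : ℝ} (hu : u ∈ J) (hv : v ∈ K) :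
    HasDerivAt (fun v => levelDir F (γ (u, v)))
      ((fderiv ℝ s (γ (u, v)) (levelVec F (γ (u, v))))⁻¹ •
        fderiv ℝ (levelDir F) (γ (u, v)) (levelVec F (γ (u, v)))) v := by
  have hq : (u, v) ∈ J ×ˢ K := ⟨hu, hv⟩
  refine (hasDerivAt_partial_snd (ρ := fun q => levelDir F (γ q))
    (hc.differentiableAt_dir_param h hq)).congr_deriv ?_
  rw [hc.fderiv_dir h hq, hc.deriv_snd _ hq, map_smul]

omit h in
theorem isLocallyCongruent {σ : ℝ → ℝ → Amb} {Φ : E3 ≃ᵃⁱ[ℝ] E3}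
    (hσ : IsCylinder I f J K σ ∨ IsFrameSurface I f J K σ)
    (hF : ∀ u ∈ J, ∀ v ∈ K, ((u, (F (γ (u, v))).2) : Amb) = ((σ u v).1, Φ (σ u v).2)) {x : E2}
    (hx : x ∈ ψ.source) : IsLocallyCongruent I f F Ω x := by
  refine ⟨ψ, J, K, σ, Φ, hx, hc.source_subset, hc.contDiffOn, hc.contDiffOn_symm, hσ, ?_⟩
  intro y hy
  rw [hc.target_eq] at hy
  refine ⟨hy.1, hy.2, ?_⟩
  rw [← hF _ hy.1 _ hy.2, ← hc.param_eq]
  exact Prod.ext (hc.time (y 0, y 1) ⟨hy.1, hy.2⟩) rfl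

end IsAdaptedChart

/-- If the direction of the level curves is locally constant, the surface is a cylinder: the second
coordinate is the height in that direction. -/
theorem IsPrincipalOn.isLocallyCongruent_of_eq (h : IsPrincipalOn I f F Ω) {w : E3}
    (hw : ∀ x ∈ Ω, levelDir F x = w) {x₀ : E2} (hx₀ : x₀ ∈ Ω) :
    IsLocallyCongruent I f F Ω x₀ := by
  have hw1 : ‖w‖ = 1 := by rw [← hw x₀ hx₀, norm_levelDir (h.levelVel_ne hx₀)]
  set s : E2 → ℝ := fun x => inner ℝ w (F x).2 with hs
  have hsd : ∀ x ∈ Ω, ∀ Z, fderiv ℝ s x Z = inner ℝ w (fderiv ℝ F x Z).2 := by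
    intro x hx Z
    have h1 := (hasFDerivAt_const w x).inner ℝ (h.differentiableAt hx).hasFDerivAt.snd
    have e : fderiv ℝ s x = _ := h1.fderiv
    rw [e]
    simp
  have hsY : ∀ x ∈ Ω, fderiv ℝ s x (levelVec F x) = ‖levelVel F x‖ := by
    intro x hx
    rw [hsd x hx]
    change inner ℝ w (levelVel F x) = _
    rw [levelVel_eq_smul_levelDir F x, hw x hx, inner_smul_right, real_inner_self_eq_norm_sq, hw1,
      norm_smul, hw1]
    simp
  obtain ⟨ψ, J, K, γ, hc, hx, hu₀, hv₀⟩ := h.exists_isAdaptedChart (s := s)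
    (contDiffOn_const.inner ℝ h.smooth.snd)
    (fun x hx => by
      rw [hsd x hx, ← hw x hx, levelDir, inner_smul_left, inner_levelVel_orthVec, mul_zero])
    (fun x hx => by
      rw [hsY x hx]
      exact norm_pos_iff.2 (h.levelVel_ne hx)) hx₀
  obtain ⟨σ, Φ, hσ, hσ'⟩ := exists_isCylinder hc.isOpen_fst hc.ordConnected_fst hc.fst_subset
    hc.isOpen_snd hc.ordConnected_snd hv₀ (hc.contDiffOn_space h)
    (fun q hq => hc.spacelike_fst h hq) hw1 (fun q hq => by
      have hm := hc.mem q hq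
      rw [hc.fderiv_space_snd h hq, hsY _ hm, hw _ hm,
        inv_mul_cancel₀ (norm_ne_zero_iff.2 (h.levelVel_ne hm)), one_smul]) hc.snd
  exact hc.isLocallyCongruent (Or.inl hσ) hσ' hx

/-- If the direction of the level curves is not stationary at `x₀`, it traces a regular spherical
curve near `x₀`, and the surface is a frame surface: the second coordinate is the arc length of that
curve. -/
theorem IsPrincipalOn.isLocallyCongruent_of_ne (h : IsPrincipalOn I f F Ω) {x₀ : E2} (hx₀ : x₀ ∈ Ω)
    (hne : fderiv ℝ (levelDir F) x₀ (levelVec F x₀) ≠ 0) : IsLocallyCongruent I f F Ω x₀ := by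
  set a : E3 := fderiv ℝ (levelDir F) x₀ (levelVec F x₀) with ha
  set s : E2 → ℝ := fun x => inner ℝ a (levelDir F x) with hs
  have hsd : ∀ x ∈ Ω, ∀ Z, fderiv ℝ s x Z = inner ℝ a (fderiv ℝ (levelDir F) x Z) := by
    intro x hx Z
    have h1 := (hasFDerivAt_const a x).inner ℝ (h.hasFDerivAt_dir hx)
    have e : fderiv ℝ s x = _ := h1.fderiv
    rw [e]
    simp
  set g : E2 → ℝ := fun x => inner ℝ a (fderiv ℝ (levelDir F) x (levelVec F x)) with hg
  have hgc : ContinuousOn g Ω := fun x hx =>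
    (contDiffAt_const.inner ℝ ((contDiffAt_fderiv (h.contDiffAt_dir hx)).clm_apply
      (contDiffAt_levelVec (h.contDiffAt hx)))).continuousAt.continuousWithinAt
  -- the second coordinate is the component of the direction along its derivative at `x₀`
  set Ω₁ := Ω ∩ g ⁻¹' Set.Ioi 0 with hΩ₁
  have h₁ : IsPrincipalOn I f F Ω₁ :=
    h.mono (hgc.isOpen_inter_preimage h.isOpen isOpen_Ioi) Set.inter_subset_left
  have hx₁ : x₀ ∈ Ω₁ := by
    refine ⟨hx₀, ?_⟩
    change 0 < inner ℝ a a
    rw [real_inner_self_eq_norm_sq]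
    exact pow_pos (norm_pos_iff.2 hne) 2
  have hs₁ : ContDiffOn ℝ ∞ s Ω₁ := contDiffOn_const.inner ℝ h₁.contDiffOn_dir
  obtain ⟨ψ₁, J₁, K₁, γ₁, hc₁, hxψ, hu₁, hv₁⟩ := h₁.exists_isAdaptedChart hs₁
    (fun x hx => by rw [hsd x hx.1, h.fderiv_dir_orthVec hx.1, inner_zero_right])
    (fun x hx => by
      rw [hsd x hx.1]
      exact hx.2) hx₁
  set β : ℝ → E3 := fun v => levelDir F (γ₁ ((F x₀).1, v)) with hβ
  have hβs : ContDiffOn ℝ ∞ β K₁ :=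
    contDiffOn_prodMk_left (ρ := fun q => levelDir F (γ₁ q)) (hc₁.contDiffOn_dir_param h₁) hu₁
  have hβd := fun v (hv : v ∈ K₁) => hasDerivAt_of_contDiffOn hc₁.isOpen_snd hβs hv
  have hβ0 : ∀ v ∈ K₁, deriv β v ≠ 0 := by
    intro v hv
    have hq : ((F x₀).1, v) ∈ J₁ ×ˢ K₁ := ⟨hu₁, hv⟩
    have hm := hc₁.mem _ hq
    rw [(hc₁.hasDerivAt_dir h₁ hu₁ hv).deriv]
    refine smul_ne_zero (inv_ne_zero (hc₁.snd_levelVec_pos _ hq).ne') ?_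
    intro h0
    have h2 : 0 < g (γ₁ ((F x₀).1, v)) := hm.2
    rw [hg] at h2
    simp only [h0, inner_zero_right, lt_self_iff_false] at h2
  have hsK : ∀ x ∈ ψ₁.source, s x ∈ K₁ ∧ (F x).1 ∈ J₁ := by
    intro x hx
    have h1 := ψ₁.map_source hx
    rw [hc₁.target_eq] at h1
    have h2 : x = γ₁ (ψ₁ x 0, ψ₁ x 1) := by rw [hc₁.param_eq, ψ₁.left_inv hx]
    have hq : (ψ₁ x 0, ψ₁ x 1) ∈ J₁ ×ˢ K₁ := ⟨h1.1, h1.2⟩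
    rw [h2, hc₁.snd _ hq, hc₁.time _ hq]
    exact ⟨h1.2, h1.1⟩
  have hdir : ∀ x ∈ ψ₁.source, levelDir F x = β (s x) := by
    intro x hx
    obtain ⟨hv, hu⟩ := hsK x hx
    conv_lhs => rw [hc₁.eq_param x hx]
    exact hc₁.dir_eq h₁ hu hu₁ hv
  obtain ⟨ℓ, -, hℓs, hℓ⟩ := exists_contDiffOn_antiderivative hc₁.isOpen_snd hc₁.ordConnected_snd
    ((contDiffOn_deriv hc₁.isOpen_snd hβs).norm ℝ hβ0) (s x₀) hv₁
  have h₂ : IsPrincipalOn I f F ψ₁.source := h₁.mono ψ₁.open_source hc₁.source_subset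
  set s₂ : E2 → ℝ := fun x => ℓ (s x) with hs₂
  have hsd₁ : ∀ x ∈ ψ₁.source, HasFDerivAt s (fderiv ℝ s x) x := fun x hx =>
    ((hs₁.contDiffAt (h₁.isOpen.mem_nhds (hc₁.source_subset hx))).differentiableAt
      (by simp)).hasFDerivAt
  have hs₂d : ∀ x ∈ ψ₁.source, ∀ Z, fderiv ℝ s₂ x Z = ‖deriv β (s x)‖ * fderiv ℝ s x Z := by
    intro x hx Z
    have e : fderiv ℝ s₂ x = _ := ((hℓ _ (hsK x hx).1).comp_hasFDerivAt x (hsd₁ x hx)).fderiv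
    rw [e]
    simp
  have hdird : ∀ x ∈ ψ₁.source, ∀ Z,
      fderiv ℝ (levelDir F) x Z = fderiv ℝ s x Z • deriv β (s x) := by
    intro x hx Z
    have hev : levelDir F =ᶠ[nhds x] fun x => β (s x) := by
      filter_upwards [ψ₁.open_source.mem_nhds hx] with y hy using hdir y hy
    have e : fderiv ℝ (fun x => β (s x)) x = _ :=
      ((hβd _ (hsK x hx).1).hasFDerivAt.comp x (hsd₁ x hx)).fderiv
    rw [hev.fderiv_eq, e]
    simp
  obtain ⟨ψ, J, K, γ, hc, hx, hu₀, hv₀⟩ := h₂.exists_isAdaptedChart (s := s₂)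
    (hℓs.comp (hs₁.mono hc₁.source_subset) fun x hx => (hsK x hx).1)
    (fun x hx => by
      have hx' := (hc₁.source_subset hx).1
      rw [hs₂d x hx, hsd x hx', h.fderiv_dir_orthVec hx', inner_zero_right, mul_zero])
    (fun x hx => by
      have hx' := hc₁.source_subset hx
      rw [hs₂d x hx, hsd x hx'.1]
      exact mul_pos (norm_pos_iff.2 (hβ0 _ (hsK x hx).1)) hx'.2) hxψ
  set α : ℝ → E3 := fun v => levelDir F (γ ((F x₀).1, v)) with hα
  have hF := isFrameSurface_of_direction (f := f) hc.isOpen_fst hc.ordConnected_fst hc.fst_subset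
    hc.isOpen_snd hc.ordConnected_snd hv₀ (hc.contDiffOn_space h₂)
    (fun q hq => hc.spacelike_fst h₂ hq) hu₀ (α := α)
    (contDiffOn_prodMk_left (ρ := fun q => levelDir F (γ q)) (hc.contDiffOn_dir_param h₂) hu₀)
    (fun v hv => norm_levelDir (h₂.levelVel_ne (hc.mem _ ⟨hu₀, hv⟩)))
    (fun v hv => by
      have hq : ((F x₀).1, v) ∈ J ×ˢ K := ⟨hu₀, hv⟩
      have hm := hc.mem _ hq
      have hp := hc.snd_levelVec_pos _ hq
      rw [(hc.hasDerivAt_dir h₂ hu₀ hv).deriv, hdird _ hm, norm_smul, norm_smul, norm_inv,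
        Real.norm_of_nonneg hp.le]
      rw [hs₂d _ hm] at hp ⊢
      have hb := norm_pos_iff.2 (hβ0 _ (hsK _ hm).1)
      have hp' := (mul_pos_iff_of_pos_left hb).1 hp
      rw [Real.norm_of_nonneg hp'.le]
      field_simp)
    (m := fun q => (fderiv ℝ s₂ (γ q) (levelVec F (γ q)))⁻¹ * ‖levelVel F (γ q)‖)
    (fun q hq => mul_pos (inv_pos.2 (hc.snd_levelVec_pos q hq))
      (norm_pos_iff.2 (h₂.levelVel_ne (hc.mem q hq))))
    (fun q hq => by
      rw [hc.fderiv_space_snd h₂ hq]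
      congr 1
      exact hc.dir_eq h₂ hq.1 hu₀ hq.2)
    (fun q hq => by
      have e : α q.2 = levelDir F (γ q) := hc.dir_eq h₂ hu₀ hq.1 hq.2
      rw [e]
      exact hc.inner_dir_fderiv_space_fst h₂ hq)
  obtain ⟨χ, J', K', σ, Φ, e1, e2, e3⟩ := hc.isLocallyCongruent (Φ := AffineIsometryEquiv.refl ℝ E3)
    (Or.inr hF) (fun u _ v _ => rfl) hx
  exact ⟨χ, J', K', σ, Φ, e1,
    e2.trans (hc₁.source_subset.trans Set.inter_subset_left), e3⟩

/-- The points near which the local expression is congruent to a surface of one of the two families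
are dense: near any other point the direction of the level curves is stationary. -/
theorem IsPrincipalOn.exists_isLocallyCongruent (h : IsPrincipalOn I f F Ω) (hΩ : Ω.Nonempty) :
    ∃ x ∈ Ω, IsLocallyCongruent I f F Ω x := by
  by_cases hex : ∃ x ∈ Ω, fderiv ℝ (levelDir F) x (levelVec F x) ≠ 0
  · obtain ⟨x, hx, hne⟩ := hex
    exact ⟨x, hx, h.isLocallyCongruent_of_ne hx hne⟩
  · push Not at hex
    obtain ⟨x₀, hx₀⟩ := hΩ
    obtain ⟨ε, hε, hball⟩ := Metric.isOpen_iff.1 h.isOpen x₀ hx₀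
    have h' : IsPrincipalOn I f F (Metric.ball x₀ ε) := h.mono Metric.isOpen_ball hball
    have hzero : ∀ x ∈ Metric.ball x₀ ε, fderiv ℝ (levelDir F) x = 0 := by
      intro x hx
      have hx' := hball hx
      ext1 Z
      obtain ⟨a, b, rfl⟩ := exists_eq_smul_add_smul
        (timeForm_orthVec_ne_zero (h.levelVel_ne hx') (h.regular x hx')) (fst_levelVec F x)
        (m := levelForm F x) (by
          rw [levelForm_levelVec]
          exact pow_ne_zero 2 (norm_ne_zero_iff.2 (h.levelVel_ne hx'))) Z
      rw [map_add, map_smul, map_smul, h.fderiv_dir_orthVec hx', hex x hx']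
      simp
    have hconst : ∀ x ∈ Metric.ball x₀ ε, levelDir F x = levelDir F x₀ := fun x hx =>
      Metric.isOpen_ball.is_const_of_fderiv_eq_zero (convex_ball x₀ ε).isPreconnected
        (fun y hy => (h'.hasFDerivAt_dir hy).differentiableAt.differentiableWithinAt)
        hzero hx (Metric.mem_ball_self hε)
    obtain ⟨χ, J', K', σ, Φ, e1, e2, e3⟩ :=
      h'.isLocallyCongruent_of_eq hconst (Metric.mem_ball_self hε)
    exact ⟨x₀, hx₀, χ, J', K', σ, Φ, e1, e2.trans hball, e3⟩

end Local

/-! ### The metric and the shape operator -/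

section Metric

variable {f : ℝ → ℝ} {x : Amb}

theorem metric_add_left (f : ℝ → ℝ) (x u v w : Amb) :
    metric f x (u + v) w = metric f x u w + metric f x v w := by
  simp only [metric, Prod.fst_add, Prod.snd_add, inner_add_left]
  ring

theorem metric_smul_left (f : ℝ → ℝ) (x : Amb) (c : ℝ) (v w : Amb) :
    metric f x (c • v) w = c * metric f x v w := by
  simp only [metric, Prod.smul_fst, Prod.smul_snd, real_inner_smul_left, smul_eq_mul]
  ring

theorem metric_sub_left (f : ℝ → ℝ) (x u v w : Amb) :
    metric f x (u - v) w = metric f x u w - metric f x v w := by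
  simp only [metric, Prod.fst_sub, Prod.snd_sub, inner_sub_left]
  ring

theorem metric_dt (f : ℝ → ℝ) (x v : Amb) : metric f x dt v = -v.1 := by
  simp [metric, dt]

/-- The metric is nondegenerate. -/
theorem eq_zero_of_metric_eq_zero (hx : f x.1 ≠ 0) {v : Amb} (h : ∀ w, metric f x v w = 0) :
    v = 0 := by
  have h1 : v.1 = 0 := by simpa [metric] using h (1, 0)
  have h2 : v.2 = 0 := by simpa [metric, hx] using h (0, v.2)
  exact Prod.ext h1 h2

end Metric

section Surface

variable {M : Type*} [TopologicalSpace M] [ChartedSpace E2 M]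
  {I : Set ℝ} {f : ℝ → ℝ} {φ : M → Amb}

/-- The expression of the surface in the chart `e`. -/
def chartExpr (φ : M → Amb) (e : OpenPartialHomeomorph M E2) : E2 → Amb := φ ∘ e.symm

theorem push_eq (hφ : IsSpacelike I f φ) (p : M) :
    @Eq (E2 →L[ℝ] Amb) (push φ p)
      (fderiv ℝ (chartExpr φ (chartAt E2 p)) (chartAt E2 p p)) := by
  have h : MDifferentiableAt (𝓡 2) 𝓘(ℝ, Amb) φ p := (hφ.smooth p).mdifferentiableAt (by simp)
  have e : push φ p = fderivWithin ℝ (writtenInExtChartAt (𝓡 2) 𝓘(ℝ, Amb) p φ)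
    (Set.range (𝓡 2)) (extChartAt (𝓡 2) p p) := h.mfderiv
  refine Eq.trans e ?_
  simp only [mfld_simps, fderivWithin_univ]
  rfl

theorem fst_push (hφ : IsSpacelike I f φ) (p : M) (Y : TangentSpace (𝓡 2) p) :
    (push φ p Y).1 = timeForm (chartExpr φ (chartAt E2 p)) (chartAt E2 p p) Y :=
  congrArg (fun l : E2 →L[ℝ] Amb => (l Y).1) (push_eq hφ p)

/-- The second derivative of the surface at `p` in the preferred chart at `p`. -/
def hessian (φ : M → Amb) (p : M) (X Y : TangentSpace (𝓡 2) p) : Amb :=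
  fderiv ℝ (fun x : E2 => fderiv ℝ (chartExpr φ (chartAt E2 p)) x Y) (chartAt E2 p p) X

theorem covDeriv_eq (f : ℝ → ℝ) (φ : M → Amb) (p : M) (X Y : TangentSpace (𝓡 2) p) :
    covDeriv f φ p X Y =
      hessian φ p X Y + christoffel f (φ p) (push φ p X) (push φ p Y) := rfl

theorem isPrincipalAt_iff_push (hφ : IsSpacelike I f φ) (p : M) :
    IsPrincipalAt (chartExpr φ (chartAt E2 p)) (chartAt E2 p p) ↔
      ∀ X Y : TangentSpace (𝓡 2) p, (push φ p Y).1 = 0 →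
        inner ℝ (push φ p X).2 (push φ p Y).2 = 0 → ∃ Z, hessian φ p X Y = push φ p Z := by
  unfold IsPrincipalAt
  rw [← push_eq hφ p]
  exact Iff.rfl

/-- The linear form `Y ↦ g̃(w, φ_* Y)`. -/
def tangentForm (f : ℝ → ℝ) (φ : M → Amb) (p : M) (w : Amb) : TangentSpace (𝓡 2) p →ₗ[ℝ] ℝ where
  toFun Y := metric f (φ p) w (push φ p Y)
  map_add' Y Z := by
    simp only [map_add, metric_comm f (φ p) w, metric_add_left]
  map_smul' c Y := by
    simp only [map_smul, metric_comm f (φ p) w, metric_smul_left, smul_eq_mul, RingHom.id_apply]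

theorem inducedMetric_tangentPart (hφ : IsSpacelike I f φ) (p : M) (w : Amb)
    (Y : TangentSpace (𝓡 2) p) :
    inducedMetric f φ p (tangentPart f φ p w) Y = metric f (φ p) w (push φ p Y) :=
  inducedMetric_raise hφ p (tangentForm f φ p w) Y

theorem eq_of_inducedMetric_eq (hφ : IsSpacelike I f φ) (p : M) {X Y : TangentSpace (𝓡 2) p}
    (h : ∀ Z, inducedMetric f φ p X Z = inducedMetric f φ p Y Z) : X = Y := by
  by_contra hne
  have h1 := hφ.pos p (X - Y) (sub_ne_zero.2 hne)
  have h2 : inducedMetric f φ p (X - Y) (X - Y) = 0 := by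
    have := inducedMetric_add_smul f φ p 1 (-1) X Y (X - Y)
    rw [one_smul, neg_one_smul, ← sub_eq_add_neg] at this
    rw [this, h]
    ring
  exact h1.ne' h2

theorem isNormal_normalPart (hφ : IsSpacelike I f φ) (p : M) (w : Amb) :
    IsNormal f φ p (normalPart f φ p w) := by
  intro X
  rw [metric_comm, normalPart, metric_sub_left, ← inducedMetric_tangentPart hφ]
  exact sub_self _

theorem metric_normalPart {p : M} {ξ : Amb} (hξ : IsNormal f φ p ξ) (w : Amb) :
    metric f (φ p) (normalPart f φ p w) ξ = metric f (φ p) w ξ := by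
  rw [normalPart, metric_sub_left, hξ, sub_zero]

/-- The normal bundle is nondegenerate: a vector orthogonal to all normal vectors is tangent. -/
theorem exists_eq_push (hφ : IsSpacelike I f φ) (hf0 : ∀ t ∈ I, f t ≠ 0) (p : M) {w : Amb}
    (hw : ∀ ξ, IsNormal f φ p ξ → metric f (φ p) w ξ = 0) :
    ∃ Z : TangentSpace (𝓡 2) p, w = push φ p Z := by
  refine ⟨tangentPart f φ p w, ?_⟩
  have h0 : normalPart f φ p w = 0 := by
    refine eq_zero_of_metric_eq_zero (hf0 _ (hφ.mem p)) fun v => ?_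
    have hv : v = push φ p (tangentPart f φ p v) + normalPart f φ p v := by
      rw [normalPart]
      abel
    rw [hv, metric_comm, metric_add_left, isNormal_normalPart hφ p w, zero_add, metric_comm,
      metric_normalPart (isNormal_normalPart hφ p v), hw _ (isNormal_normalPart hφ p v)]
  rw [normalPart, sub_eq_zero] at h0
  exact h0

theorem contDiffOn_chartExpr (hφ : IsSpacelike I f φ) {e : OpenPartialHomeomorph M E2}
    (he : e ∈ IsManifold.maximalAtlas (𝓡 2) ∞ M) : ContDiffOn ℝ ∞ (chartExpr φ e) e.target :=
  contMDiffOn_iff_contDiffOn.1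
    (hφ.smooth.comp_contMDiffOn (contMDiffOn_symm_of_mem_maximalAtlas he))

theorem contDiffAt_chartExpr (hφ : IsSpacelike I f φ) {e : OpenPartialHomeomorph M E2}
    (he : e ∈ IsManifold.maximalAtlas (𝓡 2) ∞ M) {p : M} (hp : p ∈ e.source) :
    ContDiffAt ℝ ∞ (chartExpr φ e) (e p) :=
  (contDiffOn_chartExpr hφ he).contDiffAt (e.open_target.mem_nhds (e.map_source hp))

theorem hessian_eq [IsManifold (𝓡 2) ∞ M] (hφ : IsSpacelike I f φ) (p : M)
    (X Y : TangentSpace (𝓡 2) p) :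
    hessian φ p X Y = @DFunLike.coe (E2 →L[ℝ] Amb) E2 _ _
      (fderiv ℝ (fderiv ℝ (chartExpr φ (chartAt E2 p))) (chartAt E2 p p) X) Y :=
  fderiv_fderiv_apply (contDiffAt_chartExpr hφ (IsManifold.chart_mem_maximalAtlas p)
    (mem_chart_source E2 p)) X Y

theorem hessian_add_right [IsManifold (𝓡 2) ∞ M] (hφ : IsSpacelike I f φ) (p : M)
    (X Y Z : TangentSpace (𝓡 2) p) :
    hessian φ p X (Y + Z) = hessian φ p X Y + hessian φ p X Z := by
  rw [hessian_eq hφ, hessian_eq hφ, hessian_eq hφ]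
  exact map_add (fderiv ℝ (fderiv ℝ (chartExpr φ (chartAt E2 p))) (chartAt E2 p p) X) (Y : E2) Z

theorem hessian_smul_right [IsManifold (𝓡 2) ∞ M] (hφ : IsSpacelike I f φ) (p : M)
    (c : ℝ) (X Y : TangentSpace (𝓡 2) p) : hessian φ p X (c • Y) = c • hessian φ p X Y := by
  rw [hessian_eq hφ, hessian_eq hφ]
  exact map_smul (fderiv ℝ (fderiv ℝ (chartExpr φ (chartAt E2 p))) (chartAt E2 p p) X) c (Y : E2)

theorem hessian_smul_left (p : M) (c : ℝ) (X Y : TangentSpace (𝓡 2) p) :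
    hessian φ p (c • X) Y = c • hessian φ p X Y :=
  map_smul (fderiv ℝ (fun x : E2 => fderiv ℝ (chartExpr φ (chartAt E2 p)) x Y) (chartAt E2 p p))
    c (X : E2)

/-- The defining property of the shape operator. -/
theorem inducedMetric_shapeOperator [IsManifold (𝓡 2) ∞ M] (hφ : IsSpacelike I f φ) {p : M}
    {ξ : Amb} (hξ : IsNormal f φ p ξ) (X Y : TangentSpace (𝓡 2) p) :
    inducedMetric f φ p (shapeOperator f φ p ξ X) Y = metric f (φ p) (covDeriv f φ p X Y) ξ := by
  have hadd : ∀ Y Z : TangentSpace (𝓡 2) p,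
      covDeriv f φ p X (Y + Z) = covDeriv f φ p X Y + covDeriv f φ p X Z := by
    intro Y Z
    rw [covDeriv_eq, covDeriv_eq, covDeriv_eq, hessian_add_right hφ, map_add]
    simp only [christoffel, Prod.fst_add, Prod.snd_add, inner_add_right]
    ext1
    · simp only [Prod.fst_add]
      ring
    · simp only [Prod.snd_add]
      module
  have hsmul : ∀ (c : ℝ) (Y : TangentSpace (𝓡 2) p),
      covDeriv f φ p X (c • Y) = c • covDeriv f φ p X Y := by
    intro c Y
    rw [covDeriv_eq, covDeriv_eq, hessian_smul_right hφ, map_smul]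
    simp only [christoffel, Prod.smul_fst, Prod.smul_snd, inner_smul_right]
    ext1
    · simp only [Prod.fst_add, Prod.smul_fst, smul_eq_mul]
      ring
    · simp only [Prod.snd_add, Prod.smul_snd, smul_eq_mul]
      module
  let l : TangentSpace (𝓡 2) p →ₗ[ℝ] ℝ :=
    { toFun := fun Y => metric f (φ p) (covDeriv f φ p X Y) ξ
      map_add' := fun Y Z => by rw [hadd, metric_add_left]
      map_smul' := fun c Y => by rw [hsmul, metric_smul_left]; rfl }
  have hl : (fun Y => metric f (φ p) (secondFundamentalForm f φ p X Y) ξ) = l := by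
    funext Y
    exact metric_normalPart hξ _
  rw [shapeOperator, hl]
  exact inducedMetric_raise hφ p l Y

/-! ### Class `𝒜` in a chart -/

/-- The class `𝒜` condition at the point `p`. -/
def IsClassAAt (f : ℝ → ℝ) (φ : M → Amb) (p : M) : Prop :=
  ∀ ξ : Amb, IsNormal f φ p ξ →
    ∃ c : ℝ, shapeOperator f φ p ξ (comovingTangent f φ p) = c • comovingTangent f φ p

theorem inducedMetric_comovingTangent (hφ : IsSpacelike I f φ) (p : M)
    (Y : TangentSpace (𝓡 2) p) :
    inducedMetric f φ p (comovingTangent f φ p) Y = -(push φ p Y).1 := by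
  rw [comovingTangent, inducedMetric_tangentPart hφ, metric_dt]

theorem isSpacelikeAt_chartAt (hφ : IsSpacelike I f φ) (p : M) :
    IsSpacelikeAt f (chartExpr φ (chartAt E2 p)) (chartAt E2 p p) := by
  have e : chartExpr φ (chartAt E2 p) (chartAt E2 p p) = φ p :=
    congrArg φ ((chartAt E2 p).left_inv (mem_chart_source E2 p))
  unfold IsSpacelikeAt
  rw [← push_eq hφ p, e]
  exact hφ.pos p

theorem comovingTangent_ne_zero_iff_chartAt (hφ : IsSpacelike I f φ) (p : M) :
    comovingTangent f φ p ≠ 0 ↔ timeForm (chartExpr φ (chartAt E2 p)) (chartAt E2 p p) ≠ 0 := by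
  refine not_congr ⟨fun h0 => ?_, fun h0 => ?_⟩
  · refine ContinuousLinearMap.ext fun Y => (fst_push hφ p Y).symm.trans ?_
    have h1 := inducedMetric_comovingTangent hφ p Y
    rw [h0] at h1
    simpa [inducedMetric, metric] using h1.symm
  · by_contra hne
    have h1 := hφ.pos p _ hne
    have h2 : (push φ p (comovingTangent f φ p)).1 = 0 :=
      (fst_push hφ p _).trans (congrArg (fun l : E2 →L[ℝ] ℝ => l _) h0)
    rw [inducedMetric_comovingTangent hφ, h2, neg_zero] at h1
    exact h1.false

/-- Two nonzero orthogonal tangent vectors span the tangent plane. -/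
theorem exists_eq_smul_add_smul_of_orthogonal (hφ : IsSpacelike I f φ) (p : M)
    {X Y : TangentSpace (𝓡 2) p} (hX : X ≠ 0) (hY : Y ≠ 0) (hXY : inducedMetric f φ p X Y = 0)
    (Z : TangentSpace (𝓡 2) p) : ∃ a b : ℝ, Z = a • X + b • Y ∧
      inducedMetric f φ p Z Y = b * inducedMetric f φ p Y Y := by
  let l : TangentSpace (𝓡 2) p → E2 →L[ℝ] ℝ := fun W =>
    LinearMap.toContinuousLinearMap (tangentForm f φ p (push φ p W) : E2 →ₗ[ℝ] ℝ)
  obtain ⟨a, b, hab⟩ := exists_eq_smul_add_smul (l := l X) (m := l Y) (X := X) (Y := Y)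
    (hφ.pos p X hX).ne' hXY (hφ.pos p Y hY).ne' Z
  refine ⟨a, b, hab, ?_⟩
  have hab' : Z = a • X + b • Y := hab
  rw [hab', inducedMetric_add_smul, hXY]
  ring

/-- At a point with `T ≠ 0` the class `𝒜` condition is the principal direction condition in the
preferred chart. -/
theorem isClassAAt_iff_chartAt [IsManifold (𝓡 2) ∞ M] (hφ : IsSpacelike I f φ)
    (hf0 : ∀ t ∈ I, f t ≠ 0) {p : M} (hT : comovingTangent f φ p ≠ 0) :
    IsClassAAt f φ p ↔ IsPrincipalAt (chartExpr φ (chartAt E2 p)) (chartAt E2 p p) := by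
  rw [isPrincipalAt_iff_push hφ]
  set T := comovingTangent f φ p with hTdef
  have hfp : f (φ p).1 ≠ 0 := hf0 _ (hφ.mem p)
  have hg : ∀ X Y : TangentSpace (𝓡 2) p, (push φ p Y).1 = 0 → inducedMetric f φ p X Y =
      f (φ p).1 ^ 2 * inner ℝ (push φ p X).2 (push φ p Y).2 := by
    intro X Y hY
    rw [inducedMetric, metric, hY]
    ring
  have hTg : ∀ Y : TangentSpace (𝓡 2) p, (push φ p Y).1 = 0 → inducedMetric f φ p T Y = 0 := by
    intro Y hY
    rw [inducedMetric_comovingTangent hφ, hY, neg_zero]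
  have hTY : ∀ Y : TangentSpace (𝓡 2) p, (push φ p Y).1 = 0 →
      inner ℝ (push φ p T).2 (push φ p Y).2 = 0 := by
    intro Y hY
    have := hg T Y hY
    rw [hTg Y hY] at this
    simpa [hfp] using this.symm
  -- for orthogonal vectors, one of them tangent to the fibre, the Christoffel terms are tangent
  have hcov : ∀ X Y : TangentSpace (𝓡 2) p, (push φ p Y).1 = 0 →
      inner ℝ (push φ p X).2 (push φ p Y).2 = 0 → ∃ c : ℝ,
      covDeriv f φ p X Y = hessian φ p X Y + push φ p (c • Y) := by
    intro X Y hY hXY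
    refine ⟨deriv f (φ p).1 / f (φ p).1 * (push φ p X).1, ?_⟩
    rw [covDeriv_eq, map_smul]
    congr 1
    refine Prod.ext ?_ ?_
    · simp [christoffel, hXY, hY]
    · simp [christoffel, hY, smul_smul]
  constructor
  · intro hA X Y hY hXY
    by_cases hY0 : Y = 0
    · refine ⟨0, ?_⟩
      have h0 := hessian_smul_right hφ p 0 X Y
      rw [zero_smul, zero_smul] at h0
      rw [hY0, h0, map_zero]
    have hXY' : inducedMetric f φ p X Y = 0 := by rw [hg X Y hY, hXY, mul_zero]
    obtain ⟨a, b, hab, hb⟩ := exists_eq_smul_add_smul_of_orthogonal hφ p hT hY0 (hTg Y hY) X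
    rw [hXY'] at hb
    have hb0 : b = 0 := by
      simpa [(hφ.pos p Y hY0).ne'] using hb.symm
    rw [hb0, zero_smul, add_zero] at hab
    obtain ⟨Z, hZ⟩ := exists_eq_push hφ hf0 p (w := covDeriv f φ p T Y) (fun ξ hξ => by
      obtain ⟨c, hc⟩ := hA ξ hξ
      rw [← inducedMetric_shapeOperator hφ hξ, hTdef, hc]
      have := inducedMetric_add_smul f φ p c 0 T T Y
      rw [zero_smul, add_zero] at this
      rw [this, hTg Y hY]
      ring)
    obtain ⟨c, hc⟩ := hcov T Y hY (hTY Y hY)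
    rw [hZ] at hc
    refine ⟨a • (Z - c • Y), ?_⟩
    rw [hab, hessian_smul_left, map_smul, map_sub, ← eq_sub_iff_add_eq.2 hc.symm]
  · intro hP ξ hξ
    obtain ⟨Y, hY0, hY⟩ : ∃ Y : TangentSpace (𝓡 2) p, Y ≠ 0 ∧ (push φ p Y).1 = 0 :=
      ⟨levelVec (chartExpr φ (chartAt E2 p)) (chartAt E2 p p),
        fun h0 => (comovingTangent_ne_zero_iff_chartAt hφ p).1 hT (eq_zero_of_kerVec_eq_zero h0),
        (fst_push hφ p _).trans (apply_kerVec _)⟩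
    obtain ⟨Z, hZ⟩ := hP T Y hY (hTY Y hY)
    obtain ⟨c, hc⟩ := hcov T Y hY (hTY Y hY)
    rw [hZ, ← map_add] at hc
    obtain ⟨a, b, hab, hb⟩ := exists_eq_smul_add_smul_of_orthogonal hφ p hT hY0 (hTg Y hY)
      (shapeOperator f φ p ξ T)
    rw [inducedMetric_shapeOperator hφ hξ, hc, hξ] at hb
    have hb0 : b = 0 := by
      simpa [(hφ.pos p Y hY0).ne'] using hb.symm
    refine ⟨a, ?_⟩
    rw [hab, hb0, zero_smul, add_zero]

/-! ### Change of chart -/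

section Transition

variable {e e' : OpenPartialHomeomorph M E2} (he : e ∈ IsManifold.maximalAtlas (𝓡 2) ∞ M)
  (he' : e' ∈ IsManifold.maximalAtlas (𝓡 2) ∞ M) {p : M} (hp : p ∈ e.source) (hp' : p ∈ e'.source)
include he he' hp hp'

theorem contDiffAt_transition : ContDiffAt ℝ ∞ (e ∘ e'.symm) (e' p) := by
  rw [← contMDiffAt_iff_contDiffAt]
  refine ContMDiffAt.comp _ ?_ (contMDiffAt_symm_of_mem_maximalAtlas he' (e'.map_source hp'))
  rw [e'.left_inv hp']
  exact contMDiffAt_of_mem_maximalAtlas he hp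

theorem fderiv_transition_comp (X : E2) :
    fderiv ℝ (e' ∘ e.symm) (e p) (fderiv ℝ (e ∘ e'.symm) (e' p) X) = X := by
  have h1 := (contDiffAt_transition he he' hp hp').differentiableAt (by simp)
  have h2 := (contDiffAt_transition he' he hp' hp).differentiableAt (by simp)
  have e1 : (e ∘ e'.symm) (e' p) = e p := congrArg e (e'.left_inv hp')
  rw [← e1] at h2 ⊢
  have h3 := fderiv_comp (e' p) h2 h1
  have hev : (e' ∘ e.symm) ∘ (e ∘ e'.symm) =ᶠ[nhds (e' p)] id := by
    have hc : ContinuousAt e'.symm (e' p) := e'.continuousAt_symm (e'.map_source hp')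
    filter_upwards [e'.open_target.mem_nhds (e'.map_source hp'),
      hc.eventually (by rw [e'.left_inv hp']; exact e.open_source.mem_nhds hp)] with y hy hy'
    simp only [Function.comp_apply, id_eq]
    rw [e.left_inv hy', e'.right_inv hy]
  rw [hev.fderiv_eq, fderiv_id] at h3
  exact (congrArg (fun L : E2 →L[ℝ] E2 => L X) h3).symm

theorem bijective_fderiv_transition :
    Function.Bijective (fderiv ℝ (e ∘ e'.symm) (e' p)) :=
  ⟨Function.LeftInverse.injective (fderiv_transition_comp he he' hp hp'),
    Function.RightInverse.surjective (fderiv_transition_comp he' he hp' hp)⟩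

omit [ChartedSpace E2 M] he he' in
theorem chartExpr_comp_transition :
    chartExpr φ e ∘ (e ∘ e'.symm) =ᶠ[nhds (e' p)] chartExpr φ e' := by
  have hc : ContinuousAt e'.symm (e' p) := e'.continuousAt_symm (e'.map_source hp')
  filter_upwards [hc.eventually (by rw [e'.left_inv hp']; exact e.open_source.mem_nhds hp)] with
    y hy
  simp only [chartExpr, Function.comp_apply]
  rw [e.left_inv hy]

theorem isPrincipalAt_of_chart (hφ : IsSpacelike I f φ) (h : IsPrincipalAt (chartExpr φ e) (e p)) :
    IsPrincipalAt (chartExpr φ e') (e' p) := by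
  have e1 : (e ∘ e'.symm) (e' p) = e p := congrArg e (e'.left_inv hp')
  refine IsPrincipalAt.congr (IsPrincipalAt.comp ?_ (contDiffAt_transition he he' hp hp')
    (bijective_fderiv_transition he he' hp hp').2 ?_) (chartExpr_comp_transition hp hp')
  · rw [e1]
    exact contDiffAt_chartExpr hφ he hp
  · rwa [e1]

theorem isSpacelikeAt_of_chart (hφ : IsSpacelike I f φ)
    (h : IsSpacelikeAt f (chartExpr φ e) (e p)) : IsSpacelikeAt f (chartExpr φ e') (e' p) := by
  have e1 : (e ∘ e'.symm) (e' p) = e p := congrArg e (e'.left_inv hp')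
  have h1 : IsSpacelikeAt f (chartExpr φ e ∘ (e ∘ e'.symm)) (e' p) := by
    refine IsSpacelikeAt.comp ?_
      ((contDiffAt_transition he he' hp hp').differentiableAt (by simp))
      (bijective_fderiv_transition he he' hp hp').1 ?_
    · rw [e1]
      exact (contDiffAt_chartExpr hφ he hp).differentiableAt (by simp)
    · rwa [e1]
  have hev := chartExpr_comp_transition (φ := φ) hp hp'
  intro X hX
  rw [← hev.fderiv_eq, ← hev.eq_of_nhds]
  exact h1 X hX

theorem timeForm_ne_zero_of_chart (hφ : IsSpacelike I f φ)
    (h : timeForm (chartExpr φ e) (e p) ≠ 0) : timeForm (chartExpr φ e') (e' p) ≠ 0 := by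
  intro h0
  apply h
  have e1 : (e ∘ e'.symm) (e' p) = e p := congrArg e (e'.left_inv hp')
  have hev := chartExpr_comp_transition (φ := φ) hp hp'
  have hc := fderiv_comp (e' p) (f := e ∘ e'.symm) (g := chartExpr φ e)
    (by rw [e1]; exact (contDiffAt_chartExpr hφ he hp).differentiableAt (by simp))
    ((contDiffAt_transition he he' hp hp').differentiableAt (by simp))
  rw [hev.fderiv_eq, e1] at hc
  ext1 Z
  obtain ⟨X, rfl⟩ := (bijective_fderiv_transition he he' hp hp').2 Z
  have := congrArg (fun l : E2 →L[ℝ] ℝ => l X) h0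
  simp only [timeForm, hc] at this
  exact this

end Transition

section Chart

variable [IsManifold (𝓡 2) ∞ M] {e : OpenPartialHomeomorph M E2}
  (he : e ∈ IsManifold.maximalAtlas (𝓡 2) ∞ M) {p : M} (hp : p ∈ e.source) (hφ : IsSpacelike I f φ)
include he hp hφ

theorem isSpacelikeAt_chart : IsSpacelikeAt f (chartExpr φ e) (e p) :=
  isSpacelikeAt_of_chart (IsManifold.chart_mem_maximalAtlas p) he (mem_chart_source E2 p) hp hφ
    (isSpacelikeAt_chartAt hφ p)

theorem comovingTangent_ne_zero_iff :
    comovingTangent f φ p ≠ 0 ↔ timeForm (chartExpr φ e) (e p) ≠ 0 := by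
  rw [comovingTangent_ne_zero_iff_chartAt hφ]
  have hc := IsManifold.chart_mem_maximalAtlas (I := 𝓡 2) (n := ∞) p
  exact ⟨timeForm_ne_zero_of_chart hc he (mem_chart_source E2 p) hp hφ,
    timeForm_ne_zero_of_chart he hc hp (mem_chart_source E2 p) hφ⟩

theorem isClassAAt_iff (hf0 : ∀ t ∈ I, f t ≠ 0) (hT : comovingTangent f φ p ≠ 0) :
    IsClassAAt f φ p ↔ IsPrincipalAt (chartExpr φ e) (e p) := by
  rw [isClassAAt_iff_chartAt hφ hf0 hT]
  have hc := IsManifold.chart_mem_maximalAtlas (I := 𝓡 2) (n := ∞) p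
  exact ⟨isPrincipalAt_of_chart hc he (mem_chart_source E2 p) hp hφ,
    isPrincipalAt_of_chart he hc hp (mem_chart_source E2 p) hφ⟩

end Chart

end Surface

/-! ### Congruence near a point -/

section Congruence

variable {M : Type*} [TopologicalSpace M] [ChartedSpace E2 M]
  {I : Set ℝ} {f : ℝ → ℝ} {φ : M → Amb}

theorem IsLocallyCongruent.exists_isCongruentNear [IsManifold (𝓡 2) ∞ M]
    {e : OpenPartialHomeomorph M E2}
    (he : e ∈ IsManifold.maximalAtlas (𝓡 2) ∞ M) {Ω : Set E2} (hΩ : Ω ⊆ e.target) {x : E2}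
    (h : IsLocallyCongruent I f (chartExpr φ e) Ω x) :
    ∃ (J K : Set ℝ) (σ : ℝ → ℝ → Amb), (IsCylinder I f J K σ ∨ IsFrameSurface I f J K σ) ∧
      IsCongruentNear φ (e.symm x) J K σ := by
  obtain ⟨ψ, J, K, σ, Φ, hx, hψΩ, hψ, hψ', hσ, hF⟩ := h
  have hxe : x ∈ e.target := hΩ (hψΩ hx)
  refine ⟨J, K, σ, hσ, e.trans ψ, ?_, ?_, Φ, ?_⟩
  · refine (e.trans ψ).mem_maximalAtlas_of_contMDiffOn (I := 𝓡 2) (n := ∞) ?_ ?_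
    · refine (contMDiffOn_iff_contDiffOn.2 hψ).comp
        ((contMDiffOn_of_mem_maximalAtlas he).mono ?_) ?_
      · intro y hy
        rw [OpenPartialHomeomorph.trans_source] at hy
        exact hy.1
      · intro y hy
        rw [OpenPartialHomeomorph.trans_source] at hy
        exact hy.2
    · refine (contMDiffOn_symm_of_mem_maximalAtlas he).comp
        ((contMDiffOn_iff_contDiffOn.2 hψ').mono ?_) ?_
      · intro y hy
        rw [OpenPartialHomeomorph.trans_target] at hy
        exact hy.1
      · intro y hy
        rw [OpenPartialHomeomorph.trans_target] at hy
        exact hy.2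
  · rw [OpenPartialHomeomorph.trans_source]
    exact ⟨e.map_target hxe, by rw [Set.mem_preimage, e.right_inv hxe]; exact hx⟩
  · intro y hy
    rw [OpenPartialHomeomorph.trans_target] at hy
    exact hF y hy.1

theorem IsCongruentNear.isPrincipalAt (hφ : IsSpacelike I f φ) {e : OpenPartialHomeomorph M E2}
    (he : e ∈ IsManifold.maximalAtlas (𝓡 2) ∞ M) {p : M} (hp : p ∈ e.source) {J K : Set ℝ}
    {σ : ℝ → ℝ → Amb} (hσ : IsCylinder I f J K σ ∨ IsFrameSurface I f J K σ)
    (h : IsCongruentNear φ p J K σ) : IsPrincipalAt (chartExpr φ e) (e p) := by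
  obtain ⟨e', he', hp', Φ, hΦ⟩ := h
  have hr : HasRuledLevels J K σ := hσ.elim IsCylinder.hasRuledLevels IsFrameSurface.hasRuledLevels
  exact isPrincipalAt_of_chart he' he hp' hp hφ
    (isPrincipalAt_of_hasRuledLevels hr Φ e'.open_target (contDiffOn_chartExpr hφ he') hΦ
      (e'.map_source hp'))

theorem isClassAAt_of_eq_zero [IsManifold (𝓡 2) ∞ M]
    (hφ : IsSpacelike I f φ) {p : M}
    (hT : comovingTangent f φ p = 0) : IsClassAAt f φ p := by
  refine fun ξ hξ => ⟨0, eq_of_inducedMetric_eq hφ p fun Y => ?_⟩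
  have h0 := hessian_smul_left (φ := φ) p 0 0 Y
  rw [zero_smul, zero_smul] at h0
  rw [inducedMetric_shapeOperator hφ hξ, hT, covDeriv_eq, h0]
  simp [christoffel, inducedMetric, metric]

/-- A surface of class `𝒜` is congruent to a surface of one of the two families near points
arbitrarily close to any given point with `T ≠ 0`. -/
theorem IsClassA.mem_closure [IsManifold (𝓡 2) ∞ M]
    (hf0 : ∀ t ∈ I, f t ≠ 0) (hφ : IsSpacelike I f φ)
    (hA : IsClassA f φ) {p : M} (hT : comovingTangent f φ p ≠ 0) :
    p ∈ closure {p : M | ∃ (J K : Set ℝ) (σ : ℝ → ℝ → Amb),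
      (IsCylinder I f J K σ ∨ IsFrameSurface I f J K σ) ∧ IsCongruentNear φ p J K σ} := by
  rw [mem_closure_iff]
  intro U hU hpU
  set e := chartAt E2 p with he_def
  have he : e ∈ IsManifold.maximalAtlas (𝓡 2) ∞ M := IsManifold.chart_mem_maximalAtlas p
  have hp : p ∈ e.source := mem_chart_source E2 p
  set F := chartExpr φ e with hF
  have hFs : ContDiffOn ℝ ∞ F e.target := contDiffOn_chartExpr hφ he
  have hFat : ∀ x ∈ e.target, ContDiffAt ℝ ∞ F x := fun x hx =>
    hFs.contDiffAt (e.open_target.mem_nhds hx)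
  set Ω : Set E2 := (e.target ∩ timeForm F ⁻¹' {0}ᶜ) ∩ (e.target ∩ e.symm ⁻¹' U) with hΩ
  have hΩo : IsOpen Ω := by
    refine IsOpen.inter ?_ (e.isOpen_inter_preimage_symm hU)
    refine ContinuousOn.isOpen_inter_preimage (fun x hx => ?_) e.open_target isOpen_compl_singleton
    exact (contDiffAt_timeForm (hFat x hx)).continuousAt.continuousWithinAt
  have hprin : IsPrincipalOn I f F Ω := by
    have hsrc : ∀ x ∈ Ω, e.symm x ∈ e.source := fun x hx => e.map_target hx.1.1
    have hinv : ∀ x ∈ Ω, e (e.symm x) = x := fun x hx => e.right_inv hx.1.1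
    refine ⟨hΩo, hFs.mono fun x hx => hx.1.1, fun x _ => hφ.mem _, fun x hx => ?_,
      fun x hx => hx.1.2, fun x hx => ?_⟩
    · rw [← hinv x hx]
      exact isSpacelikeAt_chart he (hsrc x hx) hφ
    · have ht : timeForm F (e (e.symm x)) ≠ 0 := by
        rw [hinv x hx]
        exact hx.1.2
      rw [← hinv x hx]
      exact (isClassAAt_iff he (hsrc x hx) hφ hf0
        ((comovingTangent_ne_zero_iff he (hsrc x hx) hφ).2 ht)).1 (hA _)
  have hne : Ω.Nonempty := by
    refine ⟨e p, ⟨e.map_source hp, (comovingTangent_ne_zero_iff he hp hφ).1 hT⟩,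
      e.map_source hp, ?_⟩
    rw [Set.mem_preimage, e.left_inv hp]
    exact hpU
  obtain ⟨x, hx, hloc⟩ := hprin.exists_isLocallyCongruent hne
  exact ⟨e.symm x, hx.2.2, hloc.exists_isCongruentNear he fun y hy => hy.1.1⟩

/-- The principal direction condition is closed where `T ≠ 0`. -/
theorem isClassAAt_of_mem_closure [IsManifold (𝓡 2) ∞ M]
    (hf0 : ∀ t ∈ I, f t ≠ 0) (hφ : IsSpacelike I f φ) {p : M}
    (hT : comovingTangent f φ p ≠ 0) (hp : p ∈ closure {p : M |
      ∃ (J K : Set ℝ) (σ : ℝ → ℝ → Amb), (IsCylinder I f J K σ ∨ IsFrameSurface I f J K σ) ∧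
        IsCongruentNear φ p J K σ}) : IsClassAAt f φ p := by
  set e := chartAt E2 p with he_def
  have he : e ∈ IsManifold.maximalAtlas (𝓡 2) ∞ M := IsManifold.chart_mem_maximalAtlas p
  have hpe : p ∈ e.source := mem_chart_source E2 p
  set F := chartExpr φ e with hF
  have ht := (comovingTangent_ne_zero_iff he hpe hφ).1 hT
  have hFp : ContDiffAt ℝ ∞ F (e p) := contDiffAt_chartExpr hφ he hpe
  have hV := levelVel_ne_zero (isSpacelikeAt_chart he hpe hφ) ht
  rw [isClassAAt_iff he hpe hφ hf0 hT, isPrincipalAt_iff_fderiv_levelDir hFp ht hV]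
  by_contra hne
  have hcont : ContinuousAt (fun x => fderiv ℝ (levelDir F) x (orthVec F x)) (e p) :=
    ((contDiffAt_fderiv (contDiffAt_levelDir hFp hV)).clm_apply
      (contDiffAt_orthVec hFp)).continuousAt
  have hev := (e.continuousAt hpe).eventually
    ((hcont.eventually_ne hne).and ((contDiffAt_timeForm hFp).continuousAt.eventually_ne ht))
  obtain ⟨q, ⟨⟨hq1, hq2⟩, hqe⟩, J, K, σ, hσ, hc⟩ := mem_closure_iff_nhds.1 hp _
    (Filter.inter_mem hev (e.open_source.mem_nhds hpe))
  exact hq1 ((isPrincipalAt_iff_fderiv_levelDir (contDiffAt_chartExpr hφ he hqe) hq2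
    (levelVel_ne_zero (isSpacelikeAt_chart he hqe hφ) hq2)).1 (hc.isPrincipalAt hφ he hqe hσ))

end Congruence

end RobertsonWalker

end

theorem mainTheorem1 {M : Type*} [TopologicalSpace M] [ChartedSpace RobertsonWalker.E2 M]
    [IsManifold (𝓡 2) ∞ M] (I : Set ℝ) (hI : IsOpen I) (hI' : I.OrdConnected)
    (f : ℝ → ℝ) (hf : ContDiffOn ℝ ∞ f I) (hf0 : ∀ t ∈ I, f t ≠ 0)
    (φ : M → RobertsonWalker.Amb) (hφ : RobertsonWalker.IsSpacelike I f φ) :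
    RobertsonWalker.IsClassA f φ ↔
      {p : M | RobertsonWalker.comovingTangent f φ p ≠ 0} ⊆
        closure {p : M | ∃ (J K : Set ℝ) (σ : ℝ → ℝ → RobertsonWalker.Amb),
          (RobertsonWalker.IsCylinder I f J K σ ∨ RobertsonWalker.IsFrameSurface I f J K σ) ∧
            RobertsonWalker.IsCongruentNear φ p J K σ} := by
  refine ⟨fun hA p hT => hA.mem_closure hf0 hφ hT, fun h p => ?_⟩
  by_cases hT : RobertsonWalker.comovingTangent f φ p = 0
  · exact RobertsonWalker.isClassAAt_of_eq_zero hφ hT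
  · exact RobertsonWalker.isClassAAt_of_mem_closure hf0 hφ hT (h hT)
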